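/- Let $d\ge 2$, let $\mathcal E'_{\mathrm{rad}}(\mathbb R^d)$ be the space of compactly supported complex-valued distributions on $\mathbb R^d$ that are invariant under all orthogonal transformations, and let $\langle\cdot,\cdot\rangle$ denote the duality pairing of compactly supported distributions with $C^\infty(\mathbb R^d)$. Put $\nu_d=\frac{d-2}{2}$ and let $|\mathbb S^{d-1}|$ be the surface area of the unit sphere. For $\ell\in\mathbb N_0$ let $$\varphi_\ell(z)=\frac{J_{\ell+\nu_d}(z)}{z^{\nu_d}}=\frac{z^\ell}{2^{\ell+\nu_d}}\sum_{n=0}^\infty\frac{(-1)^n}{n!\,\Gamma(\ell+\nu_d+n+1)}\Big(\frac z2\Big)^{2n},\qquad z\in\mathbb C,$$ and, for $f\in\mathcal E'_{\mathrm{rad}}(\mathbb R^d)$, $\kappa\in\mathbb C$ and $\xi\in\mathbb R^d$, $$\sigma_\ell[f,\kappa]=\frac1{|\mathbb S^{d-1}|}\big\langle f,\ \varphi_\ell(\sqrt\kappa\,|x|)^2\big\rangle,\qquad \mathcal F f(\xi)=\big\langle f,\ e^{-i\xi\cdot x}\big\rangle .$$ Let $Z_{\ell,d}=\frac{N_{\ell,d}}{|\mathbb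 S^{d-1}|}P_{\ell,d}$ be the zonal function of degree $\ell$ (the polynomial for which $Z_{\ell,d}(x\cdot y)$, $x,y\in\mathbb S^{d-1}$, is the reproducing kernel of the spherical harmonics of degree $\ell$), where $N_{\ell,d}=\binom{\ell+d-1}{\ell}-\binom{\ell+d-3}{\ell-2}$ (the last term being $0$ for $\ell<2$) and $P_{\ell,d}$ is the generalized Legendre polynomial, given for $-1<t<1$ by $$P_{\ell,d}(t)=(-1)^\ell\frac{\Gamma(\frac{d-1}2)}{2^\ell\,\Gamma(\ell+\frac{d-1}2)}(1-t^2)^{-\frac{d-3}2}\Big(\frac{d}{dt}\Big)^{\ell}(1-t^2)^{\ell+\frac{d-3}2}.$$ Then for every $f\in\mathcal E'_{\mathrm{rad}}(\mathbb R^d)$, every $\kappa\in\mathbb C\setminus\{0\}$ and every $\xi\in\mathbb R^d$, $$\mathcal F f(\xi)=(2\pi)^d\sum_{\ell=0}^\infty\sigma_\ell[f,\kappa]\,Z_{\ell,d}\Big(1-\frac{|\xi|^2}{2\kappa}\Big),$$ and the series converges absolutely. -/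

import Mathlib

open scoped Distributions ContDiff Topology

noncomputable section

namespace RadialFourier

/-- The Euclidean space `ℝ^d`. -/
abbrev E (d : ℕ) : Type := EuclideanSpace ℝ (Fin d)

/-- Complex-valued distributions on `ℝ^d` (tested against real-valued test functions). -/
abbrev Distr (d : ℕ) : Type := 𝓓'((⊤ : TopologicalSpace.Opens (E d)), ℂ)

/-- Real-valued test functions on `ℝ^d`. -/
abbrev Test (d : ℕ) : Type := 𝓓((⊤ : TopologicalSpace.Opens (E d)), ℝ)

/-- Radial distributions: those invariant under all linear isometries of `ℝ^d`. -/
def IsRadial {d : ℕ} (f : Distr d) : Prop :=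
  ∀ (A : E d ≃ₗᵢ[ℝ] E d) (u v : Test d), (∀ x, v x = u (A x)) → f v = f u

/-! ### Duality pairing between compactly supported distributions and smooth functions -/

/-- The test function `χ g`, for `χ` a test function and `g` smooth. -/
def mulTest {d : ℕ} (χ : Test d) (g : E d → ℝ) (hg : ContDiff ℝ ∞ g) : Test d where
  toFun x := χ x * g x
  contDiff' := χ.contDiff.mul hg
  hasCompactSupport' := χ.hasCompactSupport.mul_right
  tsupport_subset' := fun _ _ => trivial

/-- `χ` is a cut-off for `f`: it equals `1` on a neighbourhood of the support of `f`. -/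
def IsCutoff {d : ℕ} (f : Distr d) (χ : Test d) : Prop :=
  ∀ᶠ x in 𝓝ˢ (Distribution.dsupport f), χ x = 1

theorem exists_isCutoff {d : ℕ} (f : Distr d) (hf : IsCompact (Distribution.dsupport f)) :
    ∃ χ : Test d, IsCutoff f χ := by
  obtain ⟨R, hR⟩ := hf.isBounded.subset_closedBall (0 : E d)
  let b : ContDiffBump (0 : E d) := ⟨max R 0 + 1, max R 0 + 2, by positivity, by linarith⟩
  refine ⟨⟨b, b.contDiff, b.hasCompactSupport, fun _ _ => trivial⟩, ?_⟩
  have hsub : Distribution.dsupport f ⊆ Metric.ball (0 : E d) (max R 0 + 1) :=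
    hR.trans (Metric.closedBall_subset_ball (by have := le_max_left R 0; linarith))
  refine Filter.mem_of_superset (Metric.isOpen_ball.mem_nhdsSet.2 hsub) ?_
  intro x hx
  exact b.one_of_mem_closedBall (Metric.ball_subset_closedBall hx)

theorem contDiff_re {d : ℕ} {φ : E d → ℂ} (hφ : ContDiff ℝ ∞ φ) :
    ContDiff ℝ ∞ (fun x => (φ x).re) :=
  Complex.reCLM.contDiff.comp hφ

theorem contDiff_im {d : ℕ} {φ : E d → ℂ} (hφ : ContDiff ℝ ∞ φ) :
    ContDiff ℝ ∞ (fun x => (φ x).im) :=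
  Complex.imCLM.contDiff.comp hφ

/-- The pairing `⟨f, φ⟩` of a compactly supported distribution `f` with a smooth function
`φ : ℝ^d → ℂ`: it is `f (χ φ)`, i.e. `f (χ Re φ) + i f (χ Im φ)`, where `χ` is any test function
equal to `1` near the support of `f`. -/
def pairing {d : ℕ} (f : Distr d) (hf : IsCompact (Distribution.dsupport f))
    (φ : E d → ℂ) (hφ : ContDiff ℝ ∞ φ) : ℂ :=
  f (mulTest (exists_isCutoff f hf).choose (fun x => (φ x).re) (contDiff_re hφ)) +
    Complex.I * f (mulTest (exists_isCutoff f hf).choose (fun x => (φ x).im) (contDiff_im hφ))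

/-- A distribution annihilates the test functions supported away from its support. -/
theorem apply_eq_zero_of_disjoint {d : ℕ} (f : Distr d) (u : Test d)
    (h : Disjoint (tsupport u) (Distribution.dsupport f)) : f u = 0 := by
  classical
  have hcov : ∀ x : tsupport u, ∃ s : Set (E d),
      Distribution.IsVanishingOn f s ∧ IsOpen s ∧ (x : E d) ∈ s := fun x =>
    (Distribution.notMem_dsupport_iff (f := f) (x : E d)).1 (Set.disjoint_left.1 h x.2)
  choose s hs ho hx using hcov
  obtain ⟨ρ, hρ⟩ := SmoothPartitionOfUnity.exists_isSubordinate (modelWithCornersSelf ℝ (E d))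
    (isClosed_tsupport u) s ho
    (fun x hxu => Set.mem_iUnion.2 ⟨⟨x, hxu⟩, hx ⟨x, hxu⟩⟩)
  have hfin : {i | (Function.support (ρ i) ∩ tsupport u).Nonempty}.Finite :=
    ρ.locallyFinite.finite_nonempty_inter_compact u.hasCompactSupport
  have hsm : ∀ i, ContDiff ℝ ∞ (ρ i) := fun i => (ρ i).contMDiff.contDiff
  have hu : u = ∑ i ∈ hfin.toFinset, mulTest u (ρ i) (hsm i) := by
    ext x
    rw [FunLike.coe_sum, Finset.sum_apply]
    change u x = ∑ i ∈ hfin.toFinset, u x * ρ i x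
    rw [← Finset.mul_sum]
    by_cases hxu : x ∈ tsupport u
    · have h1 := ρ.sum_eq_one hxu
      rw [finsum_eq_sum_of_support_subset (s := hfin.toFinset)] at h1
      · rw [h1, mul_one]
      · intro i hi
        simp only [Set.Finite.coe_toFinset, Set.mem_ofPred_eq]
        exact ⟨x, hi, hxu⟩
    · rw [image_eq_zero_of_notMem_tsupport hxu, zero_mul]
  rw [hu, map_sum]
  refine Finset.sum_eq_zero fun i _ => hs i _ ?_
  refine (closure_mono ?_).trans (hρ i)
  intro x hx h0
  exact hx (by change u x * ρ i x = 0; rw [h0, mul_zero])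

/-- The pairing does not depend on the cut-off. -/
theorem pairing_eq {d : ℕ} (f : Distr d) (hf : IsCompact (Distribution.dsupport f))
    (φ : E d → ℂ) (hφ : ContDiff ℝ ∞ φ) (χ : Test d) (hχ : IsCutoff f χ) :
    pairing f hf φ hφ =
      f (mulTest χ (fun x => (φ x).re) (contDiff_re hφ)) +
        Complex.I * f (mulTest χ (fun x => (φ x).im) (contDiff_im hφ)) := by
  have key : ∀ (χ₁ χ₂ : Test d) (g : E d → ℝ) (hg : ContDiff ℝ ∞ g), IsCutoff f χ₁ →
      IsCutoff f χ₂ → f (mulTest χ₁ g hg) = f (mulTest χ₂ g hg) := by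
    intro χ₁ χ₂ g hg h₁ h₂
    rw [← sub_eq_zero, ← map_sub]
    refine apply_eq_zero_of_disjoint f _ (Set.disjoint_right.2 fun x hx => ?_)
    rw [notMem_tsupport_iff_eventuallyEq]
    have h₁' := h₁.filter_mono (nhds_le_nhdsSet hx)
    have h₂' := h₂.filter_mono (nhds_le_nhdsSet hx)
    filter_upwards [h₁', h₂'] with y hy₁ hy₂
    change χ₁ y * g y - χ₂ y * g y = 0
    rw [hy₁, hy₂, sub_self]
  have hc := (exists_isCutoff f hf).choose_spec
  rw [pairing, key _ χ _ _ hc hχ, key _ χ _ _ hc hχ]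

/-! ### Fourier transform -/

theorem contDiff_expFun {d : ℕ} (ξ : E d) :
    ContDiff ℝ ∞ (fun x : E d => Complex.exp (-Complex.I * ((inner ℝ ξ x : ℝ) : ℂ))) :=
  (contDiff_const.mul
    (Complex.ofRealCLM.contDiff.comp (contDiff_const.inner ℝ contDiff_id))).cexp

/-- `F f (ξ) = ⟨f, x ↦ exp(-i ξ·x)⟩`. -/
def fourier {d : ℕ} (f : Distr d) (hf : IsCompact (Distribution.dsupport f)) (ξ : E d) : ℂ :=
  pairing f hf (fun x => Complex.exp (-Complex.I * ((inner ℝ ξ x : ℝ) : ℂ))) (contDiff_expFun ξ)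

/-! ### The functions `φ_ℓ` and the `κ`-moments -/

/-- `ν_d = (d - 2) / 2`. -/
def nu (d : ℕ) : ℝ := ((d : ℝ) - 2) / 2

/-- `φ_ℓ(z) = J_{ℓ+ν_d}(z) / z^{ν_d}`, as the entire function given by its power series. -/
def phi (d ℓ : ℕ) (z : ℂ) : ℂ :=
  z ^ ℓ / (((2 : ℝ) ^ ((ℓ : ℝ) + nu d) : ℝ) : ℂ) *
    ∑' n : ℕ, (-1 : ℂ) ^ n /
      ((n.factorial : ℂ) * ((Real.Gamma ((ℓ : ℝ) + nu d + (n : ℝ) + 1) : ℝ) : ℂ)) *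
      (z / 2) ^ (2 * n)

theorem inv_gamma_bounded (d ℓ : ℕ) : ∃ C : ℝ, ∀ n : ℕ,
    |(Real.Gamma ((ℓ : ℝ) + nu d + (n : ℝ) + 1))⁻¹| ≤ C := by
  have hpos : ∀ n : ℕ, 1 ≤ (ℓ : ℝ) + nu d + ((n + 1 : ℕ) : ℝ) + 1 := by
    intro n
    have h1 : (0 : ℝ) ≤ ℓ := Nat.cast_nonneg _
    have h2 : (0 : ℝ) ≤ d := Nat.cast_nonneg _
    have h3 : (0 : ℝ) ≤ n := Nat.cast_nonneg _
    push_cast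
    unfold nu
    linarith
  have hmono : ∀ n : ℕ, Real.Gamma ((ℓ : ℝ) + nu d + ((0 + 1 : ℕ) : ℝ) + 1) ≤
      Real.Gamma ((ℓ : ℝ) + nu d + ((n + 1 : ℕ) : ℝ) + 1) := by
    intro n
    induction n with
    | zero => exact le_rfl
    | succ n ih =>
      have h := hpos n
      have e : (ℓ : ℝ) + nu d + ((n + 1 + 1 : ℕ) : ℝ) + 1 =
          ((ℓ : ℝ) + nu d + ((n + 1 : ℕ) : ℝ) + 1) + 1 := by push_cast; ring
      have hg := Real.Gamma_pos_of_pos (lt_of_lt_of_le one_pos h)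
      have hs := Real.Gamma_add_one (ne_of_gt (lt_of_lt_of_le one_pos h))
      rw [e, hs]
      exact ih.trans (le_mul_of_one_le_left hg.le h)
  refine ⟨max |(Real.Gamma ((ℓ : ℝ) + nu d + ((0 : ℕ) : ℝ) + 1))⁻¹|
    (Real.Gamma ((ℓ : ℝ) + nu d + ((0 + 1 : ℕ) : ℝ) + 1))⁻¹, fun n => ?_⟩
  cases n with
  | zero => exact le_max_left _ _
  | succ n =>
    have h0 := Real.Gamma_pos_of_pos (lt_of_lt_of_le one_pos (hpos 0))
    have hn := Real.Gamma_pos_of_pos (lt_of_lt_of_le one_pos (hpos n))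
    rw [abs_of_pos (inv_pos.2 hn)]
    exact le_max_of_le_right (inv_anti₀ h0 (hmono n))

theorem contDiff_phi_sq (d ℓ : ℕ) (κ : ℂ) :
    ContDiff ℝ ∞ (fun x : E d => phi d ℓ (κ ^ (1 / 2 : ℂ) * (‖x‖ : ℂ)) ^ 2) := by
  obtain ⟨C, hC⟩ := inv_gamma_bounded d ℓ
  have hC0 : 0 ≤ C := (abs_nonneg _).trans (hC 0)
  let a : ℕ → ℂ := fun n => (-1 : ℂ) ^ n /
      ((n.factorial : ℂ) * ((Real.Gamma ((ℓ : ℝ) + nu d + (n : ℝ) + 1) : ℝ) : ℂ))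
  have ha : ∀ n, ‖a n‖ ≤ C / n.factorial := by
    intro n
    have : ‖a n‖ = |(Real.Gamma ((ℓ : ℝ) + nu d + (n : ℝ) + 1))⁻¹| / n.factorial := by
      simp only [a, norm_div, norm_mul, norm_pow, norm_neg, norm_one, one_pow,
        Complex.norm_natCast, Complex.norm_real, abs_inv, Real.norm_eq_abs]
      rw [one_div, mul_inv, mul_comm, div_eq_mul_inv]
    rw [this]
    gcongr
    exact hC n
  let h : ℂ → ℂ := fun w => ∑' n : ℕ, a n * w ^ n
  have hd : Differentiable ℂ h := by
    intro w
    have hU : IsOpen (Metric.ball (0 : ℂ) (‖w‖ + 1)) := Metric.isOpen_ball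
    have hs : Summable fun n : ℕ => C * ((‖w‖ + 1) ^ n / n.factorial) :=
      (Real.summable_pow_div_factorial (‖w‖ + 1)).mul_left C
    have := Complex.differentiableOn_tsum_of_summable_norm (F := fun n w => a n * w ^ n) hs
      (fun n => by fun_prop) hU (fun n z hz => by
        rw [norm_mul, norm_pow]
        have hz' : ‖z‖ ≤ ‖w‖ + 1 := by
          have := mem_ball_zero_iff.1 hz
          exact this.le
        calc ‖a n‖ * ‖z‖ ^ n ≤ C / n.factorial * (‖w‖ + 1) ^ n := by
              gcongr
              exact ha n
          _ = _ := by ring)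
    exact this.differentiableAt (hU.mem_nhds (by simp))
  have hh : ContDiff ℝ ∞ h := (hd.contDiff (n := ∞)).restrict_scalars ℝ
  have hN : ContDiff ℝ ∞ (fun x : E d => ((‖x‖ ^ 2 : ℝ) : ℂ)) :=
    Complex.ofRealCLM.contDiff.comp (contDiff_norm_sq ℝ (E := E d))
  have hsq : ∀ r : ℂ, (κ ^ (1 / 2 : ℂ) * r) ^ 2 = κ * r ^ 2 := by
    intro r
    have : (κ ^ (1 / 2 : ℂ)) ^ 2 = κ := by
      rw [one_div, show ((2 : ℂ)⁻¹) = ((2 : ℕ) : ℂ)⁻¹ by norm_num,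
        Complex.cpow_nat_inv_pow κ two_ne_zero]
    rw [mul_pow, this]
  have heq : (fun x : E d => phi d ℓ (κ ^ (1 / 2 : ℂ) * (‖x‖ : ℂ)) ^ 2) = fun x =>
      (κ * ((‖x‖ ^ 2 : ℝ) : ℂ)) ^ ℓ / ((((2 : ℝ) ^ ((ℓ : ℝ) + nu d) : ℝ) : ℂ)) ^ 2 *
        h (κ * ((‖x‖ ^ 2 : ℝ) : ℂ) / 4) ^ 2 := by
    funext x
    have hser : (∑' n : ℕ, (-1 : ℂ) ^ n /
        ((n.factorial : ℂ) * ((Real.Gamma ((ℓ : ℝ) + nu d + (n : ℝ) + 1) : ℝ) : ℂ)) *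
        (κ ^ (1 / 2 : ℂ) * (‖x‖ : ℂ) / 2) ^ (2 * n)) =
        h (κ * ((‖x‖ ^ 2 : ℝ) : ℂ) / 4) := by
      refine tsum_congr fun n => ?_
      rw [pow_mul, div_pow, hsq, Complex.ofReal_pow]
      norm_num [a]
    unfold phi
    rw [hser, mul_pow, div_pow, ← pow_mul, mul_comm ℓ 2, pow_mul, hsq, Complex.ofReal_pow]
  rw [heq]
  exact (((contDiff_const.mul hN).pow ℓ).div_const _).mul
    ((hh.comp ((contDiff_const.mul hN).div_const _)).pow 2)

/-- The surface area `|S^{d-1}|` of the unit sphere of `ℝ^d`. -/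
def sphereArea (d : ℕ) : ℝ :=
  (MeasureTheory.volume : MeasureTheory.Measure (E d)).toSphere.real Set.univ

/-- The `κ`-moment `σ_ℓ[f, κ] = |S^{d-1}|⁻¹ ⟨f, φ_ℓ(√κ |x|)²⟩`. -/
def moment {d : ℕ} (f : Distr d) (hf : IsCompact (Distribution.dsupport f)) (κ : ℂ) (ℓ : ℕ) : ℂ :=
  1 / (sphereArea d : ℂ) *
    pairing f hf (fun x => phi d ℓ (κ ^ (1 / 2 : ℂ) * (‖x‖ : ℂ)) ^ 2) (contDiff_phi_sq d ℓ κ)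

/-! ### Zonal functions -/

/-- The generalized Legendre polynomial `P_{ℓ,d}`, the multiple of the Gegenbauer polynomial of
degree `ℓ` and index `ν_d` (Chebyshev polynomial if `d = 2`) with `P_{ℓ,d}(1) = 1`, written out
in powers of `(1 - t)/2`. See `legendre_eval_eq_rodrigues` for Rodrigues' formula. -/
def legendre (d ℓ : ℕ) : Polynomial ℝ :=
  ∑ j ∈ Finset.range (ℓ + 1),
    Polynomial.C ((-1 : ℝ) ^ j * (ℓ.choose j : ℝ) *
      ((ascPochhammer ℝ j).eval ((ℓ : ℝ) + (d : ℝ) - 2) /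
        (ascPochhammer ℝ j).eval (((d : ℝ) - 1) / 2))) *
      (Polynomial.C (1 / 2 : ℝ) * (1 - Polynomial.X)) ^ j

theorem ascPochhammer_mul_shift (x : ℝ) (m n : ℕ) :
    (ascPochhammer ℝ m).eval x * (ascPochhammer ℝ n).eval (x + m) =
      (ascPochhammer ℝ (m + n)).eval x := by
  rw [← ascPochhammer_mul, Polynomial.eval_mul, Polynomial.eval_comp]
  simp

theorem descPochhammer_mul_shift (x : ℝ) (m n : ℕ) :
    (descPochhammer ℝ m).eval x * (descPochhammer ℝ n).eval (x - m) =
      (descPochhammer ℝ (m + n)).eval x := by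
  rw [← descPochhammer_mul, Polynomial.eval_mul, Polynomial.eval_comp]
  simp

theorem descPochhammer_vandermonde (x y : ℝ) (m : ℕ) :
    (descPochhammer ℝ m).eval (x + y) = ∑ i ∈ Finset.range (m + 1), (m.choose i : ℝ) *
      ((descPochhammer ℝ i).eval x * (descPochhammer ℝ (m - i)).eval y) := by
  have h := Ring.descPochhammer_smeval_add m (Commute.all x y)
  rw [Finset.Nat.sum_antidiagonal_eq_sum_range_succ_mk] at h
  have e : ∀ (k : ℕ) (z : ℝ), (descPochhammer ℤ k).smeval z = (descPochhammer ℝ k).eval z := by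
    intro k z
    rw [← Polynomial.aeval_eq_smeval, Polynomial.aeval_def, Polynomial.eval₂_eq_eval_map,
      descPochhammer_map]
  simpa only [e] using h

theorem Gamma_add_nat (x : ℝ) (hx : 0 < x) (n : ℕ) :
    Real.Gamma (n + x) = (ascPochhammer ℝ n).eval x * Real.Gamma x := by
  induction n with
  | zero => simp
  | succ n ih =>
    have : ((n + 1 : ℕ) : ℝ) + x = (n + x) + 1 := by push_cast; ring
    rw [this, Real.Gamma_add_one (by positivity), ih, ascPochhammer_succ_eval]
    ring

/-- Expansion in powers of `u` of the sum given by Leibniz' rule in Rodrigues' formula. -/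
theorem leibniz_sum_eq (a u : ℝ) (ℓ : ℕ) :
    ∑ i ∈ Finset.range (ℓ + 1), (ℓ.choose i : ℝ) * (-1) ^ i *
      ((descPochhammer ℝ i).eval (ℓ + a) * (descPochhammer ℝ (ℓ - i)).eval (ℓ + a)) *
      (u ^ i * (1 - u) ^ (ℓ - i)) =
    ∑ m ∈ Finset.range (ℓ + 1), (-1 : ℝ) ^ m * (ℓ.choose m : ℝ) *
      ((ascPochhammer ℝ m).eval (ℓ + (2 * a + 1)) *
        (ascPochhammer ℝ (ℓ - m)).eval (a + 1 + m)) * u ^ m := by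
  have hexp : ∀ i ∈ Finset.range (ℓ + 1), (ℓ.choose i : ℝ) * (-1) ^ i *
      ((descPochhammer ℝ i).eval (ℓ + a) * (descPochhammer ℝ (ℓ - i)).eval (ℓ + a)) *
      (u ^ i * (1 - u) ^ (ℓ - i)) =
      ∑ m ∈ Finset.Ico i (ℓ + 1), (-1 : ℝ) ^ m * (ℓ.choose m : ℝ) *
        (descPochhammer ℝ (ℓ - m)).eval (ℓ + a) * u ^ m * ((m.choose i : ℝ) *
          ((descPochhammer ℝ i).eval (ℓ + a) * (descPochhammer ℝ (m - i)).eval (a + m))) := by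
    intro i hi
    have hi' : i ≤ ℓ := Nat.lt_succ_iff.1 (Finset.mem_range.1 hi)
    have hb : (1 - u) ^ (ℓ - i) = ∑ k ∈ Finset.range (ℓ + 1 - i),
        (-1 : ℝ) ^ k * u ^ k * ((ℓ - i).choose k : ℝ) := by
      rw [show (1 - u) = -u + 1 by ring, add_pow, show ℓ - i + 1 = ℓ + 1 - i by omega]
      refine Finset.sum_congr rfl fun k _ => ?_
      rw [one_pow, mul_one, neg_pow]
    rw [hb, Finset.sum_Ico_eq_sum_range, Finset.mul_sum, Finset.mul_sum]
    refine Finset.sum_congr rfl fun k hk => ?_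
    have hk' : i + k ≤ ℓ := by have := Finset.mem_range.1 hk; omega
    have hc : (ℓ.choose (i + k) : ℝ) * ((i + k).choose i : ℝ) =
        (ℓ.choose i : ℝ) * ((ℓ - i).choose k : ℝ) := by
      have := Nat.choose_mul (n := ℓ) (k := i + k) (s := i) (Nat.le_add_right i k)
      rw [Nat.add_sub_cancel_left] at this
      exact_mod_cast this
    have hp := descPochhammer_mul_shift ((ℓ : ℝ) + a) (ℓ - (i + k)) k
    have h1 : (ℓ : ℝ) + a - ((ℓ - (i + k) : ℕ) : ℝ) = a + ((i + k : ℕ) : ℝ) := by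
      rw [Nat.cast_sub hk']; ring
    rw [h1, show ℓ - (i + k) + k = ℓ - i by omega] at hp
    rw [Nat.add_sub_cancel_left, ← hp, pow_add, pow_add]
    linear_combination (-((-1 : ℝ) ^ i * (-1) ^ k * u ^ i * u ^ k *
      (descPochhammer ℝ i).eval (ℓ + a) * (descPochhammer ℝ (ℓ - (i + k))).eval (ℓ + a) *
      (descPochhammer ℝ k).eval (a + ((i + k : ℕ) : ℝ)))) * hc
  rw [Finset.sum_congr rfl hexp, Finset.sum_comm' (t' := Finset.range (ℓ + 1))
    (s' := fun m => Finset.range (m + 1))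
    (by intro x y; simp only [Finset.mem_range, Finset.mem_Ico]; omega)]
  refine Finset.sum_congr rfl fun m hm => ?_
  have hm' : m ≤ ℓ := Nat.lt_succ_iff.1 (Finset.mem_range.1 hm)
  rw [← Finset.mul_sum, ← descPochhammer_vandermonde, descPochhammer_eval_eq_ascPochhammer,
    descPochhammer_eval_eq_ascPochhammer]
  rw [show (ℓ : ℝ) + a + (a + m) - m + 1 = ℓ + (2 * a + 1) by ring,
    show (ℓ : ℝ) + a - ((ℓ - m : ℕ) : ℝ) + 1 = a + 1 + m by rw [Nat.cast_sub hm']; ring]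
  ring

/-- Rodrigues' formula: for `-1 < t < 1`,
`P_{ℓ,d}(t) = (-1)^ℓ R_ℓ (1-t²)^{-(d-3)/2} (d/dt)^ℓ (1-t²)^{ℓ+(d-3)/2}` with
`R_ℓ = Γ((d-1)/2) / (2^ℓ Γ(ℓ+(d-1)/2))`. -/
theorem legendre_eval_eq_rodrigues (d ℓ : ℕ) (hd : 2 ≤ d) (t : ℝ) (ht : t ∈ Set.Ioo (-1) 1) :
    (legendre d ℓ).eval t = (-1) ^ ℓ *
      (Real.Gamma (((d : ℝ) - 1) / 2) / (2 ^ ℓ * Real.Gamma (ℓ + ((d : ℝ) - 1) / 2))) *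
      (1 - t ^ 2) ^ (-(((d : ℝ) - 3) / 2)) *
      iteratedDeriv ℓ (fun s : ℝ => (1 - s ^ 2) ^ ((ℓ : ℝ) + ((d : ℝ) - 3) / 2)) t := by
  obtain ⟨ht1, ht2⟩ := ht
  have hd' : (2 : ℝ) ≤ d := by exact_mod_cast hd
  have hp1 : 0 < 1 - t := by linarith
  have hp2 : 0 < 1 + t := by linarith
  obtain ⟨a, ha⟩ : ∃ a : ℝ, a = ((d : ℝ) - 3) / 2 := ⟨_, rfl⟩
  have ha1 : ((d : ℝ) - 1) / 2 = a + 1 := by rw [ha]; ring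
  have ha0 : 0 < a + 1 := by rw [← ha1]; linarith
  rw [← ha, ha1, Gamma_add_nat _ ha0]
  have hG := Real.Gamma_pos_of_pos ha0
  have hA : ∀ (n : ℕ) (x : ℝ), 0 < x → 0 < (ascPochhammer ℝ n).eval x :=
    fun n x hx => ascPochhammer_pos n x hx
  -- derivatives of the two factors
  have hiter : ∀ (r : ℝ) (k : ℕ) (x : ℝ), iteratedDeriv k (fun y : ℝ => y ^ r) x =
      (descPochhammer ℝ k).eval r * x ^ (r - k) := by
    intro r k x
    rw [iteratedDeriv_eq_iterate]
    exact Real.iter_deriv_rpow_const r x k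
  have hm : ∀ k : ℕ, iteratedDeriv k (fun s : ℝ => (1 - s) ^ ((ℓ : ℝ) + a)) t =
      (-1) ^ k * ((descPochhammer ℝ k).eval ((ℓ : ℝ) + a) * (1 - t) ^ ((ℓ : ℝ) + a - k)) := by
    intro k
    have := congrFun (iteratedDeriv_comp_const_sub k (fun y : ℝ => y ^ ((ℓ : ℝ) + a)) 1) t
    rw [this, hiter, smul_eq_mul]
  have hpl : ∀ k : ℕ, iteratedDeriv k (fun s : ℝ => (1 + s) ^ ((ℓ : ℝ) + a)) t =
      (descPochhammer ℝ k).eval ((ℓ : ℝ) + a) * (1 + t) ^ ((ℓ : ℝ) + a - k) := by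
    intro k
    have := congrFun (iteratedDeriv_comp_const_add k (fun y : ℝ => y ^ ((ℓ : ℝ) + a)) 1) t
    rw [this, hiter]
  have hev : (fun s : ℝ => (1 - s ^ 2) ^ ((ℓ : ℝ) + a)) =ᶠ[𝓝 t]
      (fun s : ℝ => (1 - s) ^ ((ℓ : ℝ) + a) * (1 + s) ^ ((ℓ : ℝ) + a)) := by
    filter_upwards [Ioo_mem_nhds ht1 ht2] with s hs
    rw [← Real.mul_rpow (by linarith [hs.2]) (by linarith [hs.1])]
    congr 1
    ring
  have hcd1 : ContDiffAt ℝ ℓ (fun s : ℝ => (1 - s) ^ ((ℓ : ℝ) + a)) t :=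
    (contDiffAt_const.sub contDiffAt_id).rpow_const_of_ne hp1.ne'
  have hcd2 : ContDiffAt ℝ ℓ (fun s : ℝ => (1 + s) ^ ((ℓ : ℝ) + a)) t :=
    (contDiffAt_const.add contDiffAt_id).rpow_const_of_ne hp2.ne'
  rw [hev.iteratedDeriv_eq ℓ, iteratedDeriv_fun_mul hcd1 hcd2]
  obtain ⟨u, hu⟩ : ∃ u : ℝ, u = (1 - t) / 2 := ⟨_, rfl⟩
  have hsum : (1 - t ^ 2) ^ (-a) * (∑ i ∈ Finset.range (ℓ + 1), (ℓ.choose i : ℝ) *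
      iteratedDeriv i (fun s : ℝ => (1 - s) ^ ((ℓ : ℝ) + a)) t *
      iteratedDeriv (ℓ - i) (fun s : ℝ => (1 + s) ^ ((ℓ : ℝ) + a)) t) =
      (-1) ^ ℓ * 2 ^ ℓ * ∑ i ∈ Finset.range (ℓ + 1), (ℓ.choose i : ℝ) * (-1) ^ i *
      ((descPochhammer ℝ i).eval (ℓ + a) * (descPochhammer ℝ (ℓ - i)).eval (ℓ + a)) *
      (u ^ i * (1 - u) ^ (ℓ - i)) := by
    rw [← Finset.sum_range_reflect (fun i => (ℓ.choose i : ℝ) * (-1) ^ i *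
      ((descPochhammer ℝ i).eval (ℓ + a) * (descPochhammer ℝ (ℓ - i)).eval (ℓ + a)) *
      (u ^ i * (1 - u) ^ (ℓ - i))), Finset.mul_sum, Finset.mul_sum]
    refine Finset.sum_congr rfl fun i hi => ?_
    have hi' : i ≤ ℓ := Nat.lt_succ_iff.1 (Finset.mem_range.1 hi)
    rw [hm, hpl, show ℓ + 1 - 1 - i = ℓ - i by omega, Nat.choose_symm hi',
      show ℓ - (ℓ - i) = i by omega]
    have e1 : (1 - t) ^ (-a) * (1 - t) ^ ((ℓ : ℝ) + a - i) = 2 ^ (ℓ - i) * u ^ (ℓ - i) := by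
      rw [← Real.rpow_add hp1, ← mul_pow, hu, ← Real.rpow_natCast, Nat.cast_sub hi']
      congr 1 <;> ring
    have e2 : (1 + t) ^ (-a) * (1 + t) ^ ((ℓ : ℝ) + a - ((ℓ - i : ℕ) : ℝ)) =
        2 ^ i * (1 - u) ^ i := by
      rw [← Real.rpow_add hp2, ← mul_pow, hu, ← Real.rpow_natCast, Nat.cast_sub hi']
      congr 1 <;> ring
    have e3 : (1 - t ^ 2) ^ (-a) = (1 - t) ^ (-a) * (1 + t) ^ (-a) := by
      rw [← Real.mul_rpow hp1.le hp2.le]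
      congr 1
      ring
    have e4 : (2 : ℝ) ^ ℓ = 2 ^ (ℓ - i) * 2 ^ i := by rw [← pow_add, Nat.sub_add_cancel hi']
    have e5 : (-1 : ℝ) ^ ℓ * (-1) ^ (ℓ - i) = (-1) ^ i := by
      rw [← pow_add, show ℓ + (ℓ - i) = 2 * (ℓ - i) + i by omega, pow_add, pow_mul]
      norm_num
    calc _ = (ℓ.choose i : ℝ) * (-1) ^ i * ((descPochhammer ℝ i).eval ((ℓ : ℝ) + a) *
          (descPochhammer ℝ (ℓ - i)).eval ((ℓ : ℝ) + a)) *
          (((1 - t) ^ (-a) * (1 - t) ^ ((ℓ : ℝ) + a - i)) *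
          ((1 + t) ^ (-a) * (1 + t) ^ ((ℓ : ℝ) + a - ((ℓ - i : ℕ) : ℝ)))) := by
            rw [e3]; ring
      _ = _ := by rw [e1, e2, e4, ← e5]; ring
  rw [mul_assoc, hsum, leibniz_sum_eq, legendre, Polynomial.eval_finsetSum, Finset.mul_sum,
    Finset.mul_sum]
  refine Finset.sum_congr rfl fun m hmm => ?_
  have hm' : m ≤ ℓ := Nat.lt_succ_iff.1 (Finset.mem_range.1 hmm)
  have hs := ascPochhammer_mul_shift (a + 1) m (ℓ - m)
  rw [Nat.add_sub_cancel' hm'] at hs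
  have hm1 := (hA m _ ha0).ne'
  have hl1 := (hA ℓ _ ha0).ne'
  have h2 : ((-1 : ℝ) ^ ℓ) * (-1) ^ ℓ = 1 := by rw [← mul_pow]; norm_num
  simp only [Polynomial.eval_mul, Polynomial.eval_pow, Polynomial.eval_C, Polynomial.eval_sub,
    Polynomial.eval_one, Polynomial.eval_X]
  rw [ha1, show (1 / 2 : ℝ) * (1 - t) = u by rw [hu]; ring,
    show (ℓ : ℝ) + d - 2 = ℓ + (2 * a + 1) by rw [ha]; ring]
  field_simp
  rw [← hs]
  ring_nf
  ring_nf at h2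
  rw [h2, mul_one]

/-- The normalization `P_{ℓ,d}(1) = 1`. -/
theorem legendre_eval_one (d ℓ : ℕ) : (legendre d ℓ).eval 1 = 1 := by
  rw [legendre, Polynomial.eval_finsetSum, Finset.sum_range_succ']
  simp

/-- `N_{ℓ,d} = C(ℓ+d-1, ℓ) - C(ℓ+d-3, ℓ-2)`, the dimension of the space of spherical harmonics of
degree `ℓ` on `S^{d-1}`, for `d ≥ 2` (the second term is `0` if `ℓ < 2`). -/
def harmonicDim (d ℓ : ℕ) : ℝ :=
  ((ℓ + d - 1).choose (d - 1) : ℝ) - ((ℓ + d - 3).choose (d - 1) : ℝ)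

/-- The zonal function `Z_{ℓ,d} = (N_{ℓ,d} / |S^{d-1}|) P_{ℓ,d}` (so that `Z_{ℓ,d}(x·y)` is the
reproducing kernel of the spherical harmonics of degree `ℓ`), as a polynomial function on `ℂ`. -/
def zonal (d ℓ : ℕ) (z : ℂ) : ℂ :=
  ((harmonicDim d ℓ / sphereArea d : ℝ) : ℂ) * Polynomial.aeval z (legendre d ℓ)

end RadialFourier

end

open scoped Distributions ContDiff Topology

noncomputable section

namespace RadialFourier

/-! Write d = c + 2 and u = |ξ|²/(4κ), so that the argument of the zonal function is 1 - 2u. Both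
sides are expanded in the radial moments m_n = ⟨f, |x|^{2n}⟩ and compared coefficient by
coefficient.

Since f is radial, ⟨f, (ξ·x)^k⟩ vanishes for odd k and is a multiple of |ξ|^{2n} m_n for k = 2n. The
exponential series then gives the Fourier transform as the sum of (-|ξ|²)^n m_n / (4^n n! (d/2)_n)
(`hasSum_fourier`). On the other side, Vandermonde's identity gives the power series of φ_ℓ²
(`hasSum_phi_sq`): up to a factor depending on n only, the coefficient of κ^n |x|^{2n} is (-1)^ℓ
C(2n+c, n+ℓ+c), which vanishes for ℓ > n.

After exchanging the sums over ℓ and n, the theorem becomes a finite identity for each n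
(`sum_choose_mul_legendre`): the combination of N_ℓ P_ℓ(1-2u), ℓ ≤ n, with these binomial weights is
a single monomial in u. Expanding N_ℓ P_ℓ in powers of u turns this into a triangular orthogonality
relation between binomial coefficients, proved by telescoping (`sub_mul_sum_zonalCoeff`,
`sum_zonalCoeff`).

The exchange is legitimate because the coefficients of φ_ℓ² are O(1/n!) uniformly in ℓ, while m_n
and N_ℓ P_ℓ grow at most geometrically and only ℓ ≤ n contributes. -/

/-! ### Distributions applied termwise to power series -/

/-- Continuity on the space of test functions supported in K is a bound by finitely many seminorms;
N is the largest order among them. -/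
theorem exists_bound_of_tsupport_subset {d : ℕ} (f : Distr d)
    (K : TopologicalSpace.Compacts (E d)) :
    ∃ (N : ℕ) (C : ℝ), 0 ≤ C ∧ ∀ (v : Test d), tsupport v ⊆ K → ∀ B : ℝ, 0 ≤ B →
      (∀ i ≤ N, ∀ x, ‖iteratedFDeriv ℝ i v x‖ ≤ B) → ‖f v‖ ≤ C * B := by
  let g : ContDiffMapSupportedIn (E d) ℝ ⊤ K →L[ℝ] ℂ :=
    f.comp (TestFunction.ofSupportedInCLM ℝ (Ω := (⊤ : TopologicalSpace.Opens (E d)))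
      (n := ⊤) (F := ℝ) (K := K) (fun _ _ => trivial))
  obtain ⟨s, C, -, hC⟩ := Seminorm.bound_of_continuous
    (ContDiffMapSupportedIn.withSeminorms ℝ (E d) ℝ ⊤ K)
    ((normSeminorm ℝ ℂ).comp g.toLinearMap) (continuous_norm.comp g.continuous)
  refine ⟨s.sup id, C, C.2, fun v hv B hB hBv => ?_⟩
  let w : ContDiffMapSupportedIn (E d) ℝ ⊤ K :=
    .of_support_subset v.contDiff ((subset_tsupport _).trans hv)
  have h1 : ‖f v‖ ≤ C * (s.sup (ContDiffMapSupportedIn.seminorm ℝ (E d) ℝ ⊤ K)) w := hC w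
  refine h1.trans (mul_le_mul_of_nonneg_left ?_ C.2)
  refine Seminorm.finset_sup_apply_le hB fun i hi => ?_
  rw [ContDiffMapSupportedIn.seminorm_top_le_iff ℝ hB]
  exact fun x _ => hBv i (Finset.le_sup (f := id) hi) x

/-- A distribution may be applied termwise to a series of test functions supported in a common
compact set, if the series of the suprema of their derivatives of each order converge. -/
theorem hasSum_apply {d : ℕ} (f : Distr d) (K : TopologicalSpace.Compacts (E d))
    (u : ℕ → Test d) (v : Test d) (hu : ∀ n, tsupport (u n) ⊆ K) (hvK : tsupport v ⊆ K)
    (b : ℕ → ℕ → ℝ) (hb : ∀ k, Summable (b k))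
    (hub : ∀ k n x, ‖iteratedFDeriv ℝ k (u n) x‖ ≤ b k n)
    (hv : ∀ x, HasSum (fun n => u n x) (v x)) :
    HasSum (fun n => f (u n)) (f v) := by
  obtain ⟨N, C, hC, hf⟩ := exists_bound_of_tsupport_subset f K
  have hb0 : ∀ k n, 0 ≤ b k n := fun k n => (norm_nonneg _).trans (hub k n 0)
  let B : ℕ → ℝ := fun n => ∑ k ∈ Finset.range (N + 1), b k n
  have hB : Summable B := summable_sum fun k _ => hb k
  have hB0 : ∀ n, 0 ≤ B n := fun n => Finset.sum_nonneg fun k _ => hb0 k n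
  have hle : ∀ k ≤ N, ∀ n, b k n ≤ B n := fun k hk n =>
    Finset.single_le_sum (f := fun k => b k n) (fun k _ => hb0 k n)
      (Finset.mem_range.2 (Nat.lt_succ_of_le hk))
  have hsum : Summable fun n => f (u n) := by
    refine Summable.of_norm_bounded (hB.mul_left C) fun n => ?_
    exact hf _ (hu n) _ (hB0 n) fun i hi x => (hub i n x).trans (hle i hi n)
  refine (hsum.hasSum_iff_tendsto_nat).2 ?_
  rw [← tendsto_sub_nhds_zero_iff]
  have htail : Filter.Tendsto (fun m => C * ∑' n, B (n + m)) Filter.atTop (𝓝 0) := by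
    simpa using (tendsto_sum_nat_add B).const_mul C
  refine squeeze_zero_norm (fun m => ?_) htail
  rw [norm_sub_rev, ← map_sum, ← map_sub]
  have hBm : Summable fun n => B (n + m) := (summable_nat_add_iff m).2 hB
  -- The remainder is itself a series that may be differentiated termwise, so its derivatives up to
  -- order N are bounded by the tail of `B`.
  have hfun : ⇑(v - ∑ n ∈ Finset.range m, u n) = fun x => ∑' n, u (n + m) x := by
    funext x
    change v x - (∑ n ∈ Finset.range m, u n) x = _
    rw [FunLike.coe_sum, Finset.sum_apply, ← (hv x).tsum_eq,
      ← (hv x).summable.sum_add_tsum_nat_add m]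
    ring
  refine hf _ ?_ _ (tsum_nonneg fun n => hB0 _) fun i hi x => ?_
  · refine closure_minimal (fun x hx => ?_) K.isCompact.isClosed
    by_contra hxK
    refine hx ?_
    change v x - (∑ n ∈ Finset.range m, u n) x = 0
    rw [FunLike.coe_sum, Finset.sum_apply,
      image_eq_zero_of_notMem_tsupport fun h => hxK (hvK h),
      Finset.sum_eq_zero fun n _ => image_eq_zero_of_notMem_tsupport fun h => hxK (hu n h),
      sub_zero]
  · rw [hfun, iteratedFDeriv_tsum (N := ⊤) (v := fun k n => b k (n + m))
      (fun n => (u (n + m)).contDiff) (fun k _ => (summable_nat_add_iff m).2 (hb k))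
      (fun k n x _ => hub k (n + m) x) le_top]
    exact tsum_of_norm_bounded hBm.hasSum fun n => (hub i _ x).trans (hle i hi _)

/-- By Leibniz' rule, each further factor p costs at most 2^k times a bound for the derivatives of p
on the support of χ. The constant M also dominates the derivatives of χ, which starts the induction.
-/
theorem exists_iteratedFDeriv_mul_pow_le {d : ℕ} (χ : Test d) {p : E d → ℝ}
    (hp : ContDiff ℝ ∞ p) (k : ℕ) : ∃ M : ℝ, 0 ≤ M ∧ ∀ n, ∀ i ≤ k, ∀ x,
      ‖iteratedFDeriv ℝ i (fun y => χ y * p y ^ n) x‖ ≤ M ^ (n + 1) := by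
  have hbdd : ∀ g : E d → ℝ, ContDiff ℝ ∞ g → ∃ M : ℝ, ∀ i ≤ k, ∀ x ∈ tsupport χ,
      ‖iteratedFDeriv ℝ i g x‖ ≤ M := by
    intro g hg
    have h : ∀ i : ℕ, ∃ M : ℝ, ∀ x ∈ tsupport χ, ‖iteratedFDeriv ℝ i g x‖ ≤ M := fun i =>
      χ.hasCompactSupport.exists_bound_of_continuousOn
        (hg.continuous_iteratedFDeriv (by exact_mod_cast le_top)).continuousOn
    choose M hM using h
    refine ⟨∑ i ∈ Finset.range (k + 1), |M i|, fun i hi x hx => (hM i x hx).trans ?_⟩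
    exact (le_abs_self _).trans (Finset.single_le_sum (f := fun i => |M i|)
      (fun i _ => abs_nonneg _) (Finset.mem_range.2 (Nat.lt_succ_of_le hi)))
  obtain ⟨A, hA⟩ := hbdd χ χ.contDiff
  obtain ⟨P, hP⟩ := hbdd p hp
  have hM0 : 0 ≤ |A| + 2 ^ k * |P| := by positivity
  refine ⟨|A| + 2 ^ k * |P|, hM0, fun n => ?_⟩
  obtain ⟨M, hM⟩ : ∃ M, M = |A| + 2 ^ k * |P| := ⟨_, rfl⟩
  rw [← hM] at hM0 ⊢
  induction n with
  | zero =>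
    intro i hi x
    simp only [pow_zero, mul_one, zero_add, pow_one]
    by_cases hx : x ∈ tsupport χ
    · have := (hA i hi x hx).trans (le_abs_self A)
      have h2 : 0 ≤ 2 ^ k * |P| := by positivity
      linarith
    · have : iteratedFDeriv ℝ i χ x = 0 :=
        image_eq_zero_of_notMem_tsupport fun h => hx (tsupport_iteratedFDeriv_subset i h)
      change ‖iteratedFDeriv ℝ i χ x‖ ≤ M
      rw [this, norm_zero]
      exact hM0
  | succ n ih =>
    intro i hi x
    have hsm : ContDiff ℝ ∞ (fun y => χ y * p y ^ n) := χ.contDiff.mul (hp.pow n)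
    by_cases hx : x ∈ tsupport χ
    · have h1 := norm_iteratedFDeriv_mul_le (𝕜 := ℝ) hsm hp x (n := i)
        (by exact_mod_cast le_top)
      have he : (fun y => χ y * p y ^ (n + 1)) = fun y => (χ y * p y ^ n) * p y := by
        funext y; ring
      rw [he]
      refine h1.trans ?_
      calc _ ≤ ∑ j ∈ Finset.range (i + 1), (i.choose j : ℝ) * (M ^ (n + 1) * |P|) := by
            refine Finset.sum_le_sum fun j hj => ?_
            have hj' : j ≤ i := Nat.lt_succ_iff.1 (Finset.mem_range.1 hj)
            rw [mul_assoc]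
            have h3 := (hP (i - j) (by omega) x hx).trans (le_abs_self P)
            have h4 := ih j (hj'.trans hi) x
            gcongr
        _ = 2 ^ i * |P| * M ^ (n + 1) := by
            rw [← Finset.sum_mul]
            have := Nat.sum_range_choose i
            have h5 : ∑ j ∈ Finset.range (i + 1), (i.choose j : ℝ) = 2 ^ i := by
              exact_mod_cast this
            rw [h5]; ring
        _ ≤ M * M ^ (n + 1) := by
            have : (2 : ℝ) ^ i ≤ 2 ^ k := pow_le_pow_right₀ (by norm_num) hi
            have h6 : 2 ^ i * |P| ≤ M := by
              rw [hM]
              have := mul_le_mul_of_nonneg_right this (abs_nonneg P)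
              linarith [abs_nonneg A]
            gcongr
        _ = _ := by ring
    · have hx' : x ∉ tsupport (fun y => χ y * p y ^ (n + 1)) := fun h =>
        hx (tsupport_mul_subset_left h)
      have : iteratedFDeriv ℝ i (fun y => χ y * p y ^ (n + 1)) x = 0 :=
        image_eq_zero_of_notMem_tsupport fun h => hx' (tsupport_iteratedFDeriv_subset i h)
      rw [this, norm_zero]
      positivity

theorem tsupport_mulTest_subset {d : ℕ} (χ : Test d) (g : E d → ℝ) (hg : ContDiff ℝ ∞ g) :
    tsupport (mulTest χ g hg) ⊆ tsupport χ :=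
  tsupport_mul_subset_left

theorem exists_norm_apply_mul_pow_le {d : ℕ} (f : Distr d) (χ : Test d) {p : E d → ℝ}
    (hp : ContDiff ℝ ∞ p) : ∃ C M : ℝ, 0 ≤ C ∧ 0 ≤ M ∧
      ∀ n, ‖f (mulTest χ (fun x => p x ^ n) (hp.pow n))‖ ≤ C * M ^ n := by
  obtain ⟨N, C, hC, hf⟩ := exists_bound_of_tsupport_subset f ⟨tsupport χ, χ.hasCompactSupport⟩
  obtain ⟨M, hM, hχ⟩ := exists_iteratedFDeriv_mul_pow_le χ hp N
  refine ⟨C * M, M, by positivity, hM, fun n => ?_⟩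
  refine (hf _ (tsupport_mulTest_subset χ _ _) _ (pow_nonneg hM (n + 1))
    fun i hi x => hχ n i hi x).trans (le_of_eq (by ring))

/-- The geometric rate M of the derivative bounds depends on the order of differentiation, so
summability is required against every M. Coefficients are real here because test functions are;
complex ones are split in `hasSum_pairing`. -/
theorem hasSum_apply_mul_pow {d : ℕ} (f : Distr d) (χ : Test d) {p : E d → ℝ}
    (hp : ContDiff ℝ ∞ p) (c : ℕ → ℝ) (hc : ∀ M : ℝ, 0 ≤ M → Summable fun n => |c n| * M ^ n)
    (φ : E d → ℝ) (hφ : ContDiff ℝ ∞ φ) (h : ∀ x, HasSum (fun n => c n * p x ^ n) (φ x)) :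
    HasSum (fun n => (c n : ℂ) * f (mulTest χ (fun x => p x ^ n) (hp.pow n)))
      (f (mulTest χ φ hφ)) := by
  choose M hM hχ using exists_iteratedFDeriv_mul_pow_le χ hp
  have key := hasSum_apply f ⟨tsupport χ, χ.hasCompactSupport⟩
    (fun n => c n • mulTest χ (fun x => p x ^ n) (hp.pow n)) (mulTest χ φ hφ)
    (fun n => (closure_mono (Function.support_const_smul_subset _ _)).trans
      (tsupport_mulTest_subset χ _ _))
    (tsupport_mulTest_subset χ _ _) (fun k n => |c n| * M k ^ n * M k)
    (fun k => (hc _ (hM k)).mul_right _) (fun k n x => ?_) (fun x => ?_)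
  · simpa only [map_smul, Complex.real_smul] using key
  · have hs : ContDiffAt ℝ k (fun y => χ y * p y ^ n) x :=
      ((χ.contDiff.mul (hp.pow n)).of_le (by exact_mod_cast le_top)).contDiffAt
    have e : ⇑(c n • mulTest χ (fun x => p x ^ n) (hp.pow n)) =
        c n • fun y => χ y * p y ^ n := rfl
    rw [e, iteratedFDeriv_const_smul_apply hs, norm_smul, Real.norm_eq_abs, mul_assoc,
      ← pow_succ]
    exact mul_le_mul_of_nonneg_left (hχ k n k le_rfl x) (abs_nonneg _)
  · have := (h x).mul_left (χ x)
    refine this.congr_fun ?_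
    intro n
    change c n * (χ x * p x ^ n) = _
    ring

/-- A compactly supported distribution may be applied termwise to an everywhere convergent power
series in a smooth function. -/
theorem hasSum_pairing {d : ℕ} (f : Distr d) (hf : IsCompact (Distribution.dsupport f))
    (χ : Test d) (hχ : IsCutoff f χ) {p : E d → ℝ} (hp : ContDiff ℝ ∞ p) (c : ℕ → ℂ)
    (hc : ∀ M : ℝ, 0 ≤ M → Summable fun n => ‖c n‖ * M ^ n)
    (φ : E d → ℂ) (hφ : ContDiff ℝ ∞ φ) (h : ∀ x, HasSum (fun n => c n * (p x : ℂ) ^ n) (φ x)) :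
    HasSum (fun n => c n * f (mulTest χ (fun x => p x ^ n) (hp.pow n))) (pairing f hf φ hφ) := by
  rw [pairing_eq f hf φ hφ χ hχ]
  have h1 := hasSum_apply_mul_pow f χ hp (fun n => (c n).re)
    (fun M hM => (hc M hM).of_nonneg_of_le (fun n => by positivity) fun n =>
      mul_le_mul_of_nonneg_right (Complex.abs_re_le_norm _) (pow_nonneg hM n))
    (fun x => (φ x).re) (contDiff_re hφ) (fun x => by
      refine (Complex.hasSum_re (h x)).congr_fun fun n => ?_
      rw [← Complex.ofReal_pow, Complex.re_mul_ofReal])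
  have h2 := hasSum_apply_mul_pow f χ hp (fun n => (c n).im)
    (fun M hM => (hc M hM).of_nonneg_of_le (fun n => by positivity) fun n =>
      mul_le_mul_of_nonneg_right (Complex.abs_im_le_norm _) (pow_nonneg hM n))
    (fun x => (φ x).im) (contDiff_im hφ) (fun x => by
      refine (Complex.hasSum_im (h x)).congr_fun fun n => ?_
      rw [← Complex.ofReal_pow, Complex.im_mul_ofReal])
  refine (h1.add (h2.mul_left Complex.I)).congr_fun fun n => ?_
  nth_rewrite 1 [← Complex.re_add_im (c n)]
  ring

/-! ### Polynomial moments of a radial distribution -/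

/-- A smooth function of |x|² serves as cut-off. Its invariance lets the symmetry of f act on the
polynomial factor alone in f(χ·polynomial). -/
theorem exists_radial_isCutoff {d : ℕ} (f : Distr d) (hf : IsCompact (Distribution.dsupport f)) :
    ∃ χ : Test d, IsCutoff f χ ∧ ∀ (A : E d ≃ₗᵢ[ℝ] E d) x, χ (A x) = χ x := by
  obtain ⟨R, hR⟩ := hf.isBounded.subset_closedBall (0 : E d)
  have hz : ∀ x : E d, x ∉ Metric.closedBall (0 : E d) (|R| + 2) →
      Real.smoothTransition ((|R| + 1) ^ 2 + 1 - ‖x‖ ^ 2) = 0 := by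
    intro x hx
    rw [mem_closedBall_zero_iff, not_le] at hx
    refine Real.smoothTransition.zero_of_nonpos ?_
    nlinarith [abs_nonneg R]
  refine ⟨⟨fun x => Real.smoothTransition ((|R| + 1) ^ 2 + 1 - ‖x‖ ^ 2),
    Real.smoothTransition.contDiff.comp (contDiff_const.sub (contDiff_norm_sq ℝ)),
    HasCompactSupport.intro (isCompact_closedBall (0 : E d) (|R| + 2)) hz,
    fun _ _ => trivial⟩, ?_, fun A x => ?_⟩
  · have hsub : Distribution.dsupport f ⊆ Metric.ball (0 : E d) (|R| + 1) :=
      hR.trans (Metric.closedBall_subset_ball (by have := le_abs_self R; linarith))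
    refine Filter.mem_of_superset (Metric.isOpen_ball.mem_nhdsSet.2 hsub) ?_
    intro x hx
    rw [mem_ball_zero_iff] at hx
    refine Real.smoothTransition.one_of_one_le ?_
    nlinarith [abs_nonneg R, norm_nonneg x]
  · change Real.smoothTransition ((|R| + 1) ^ 2 + 1 - ‖A x‖ ^ 2) =
      Real.smoothTransition ((|R| + 1) ^ 2 + 1 - ‖x‖ ^ 2)
    rw [A.norm_map]

/-- The functions `x ↦ (ξ·x)^k (η·x)^m |x|^{2j}` are smooth. -/
theorem contDiff_inner_pow {d : ℕ} (ξ η : E d) (k m j : ℕ) :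
    ContDiff ℝ ∞ (fun x : E d => inner ℝ ξ x ^ k * inner ℝ η x ^ m * (‖x‖ ^ 2) ^ j) :=
  (((contDiff_const.inner ℝ contDiff_id).pow k).mul
    ((contDiff_const.inner ℝ contDiff_id).pow m)).mul ((contDiff_norm_sq ℝ).pow j)

/-- `⟨f, χ(x) (ξ·x)^k (η·x)^m |x|^{2j}⟩`. -/
def innerMoment {d : ℕ} (f : Distr d) (χ : Test d) (ξ η : E d) (k m j : ℕ) : ℂ :=
  f (mulTest χ _ (contDiff_inner_pow ξ η k m j))

theorem innerMoment_smul {d : ℕ} (f : Distr d) (χ : Test d) (ξ η : E d) (k m j : ℕ) (c : ℝ) :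
    innerMoment f χ (c • ξ) η k m j = (c : ℂ) ^ k * innerMoment f χ ξ η k m j := by
  rw [innerMoment, innerMoment, ← Complex.ofReal_pow, ← Complex.real_smul, ← map_smul]
  congr 1
  ext x
  change χ x * (inner ℝ (c • ξ) x ^ k * inner ℝ η x ^ m * (‖x‖ ^ 2) ^ j) =
    c ^ k * (χ x * (inner ℝ ξ x ^ k * inner ℝ η x ^ m * (‖x‖ ^ 2) ^ j))
  rw [real_inner_smul_left, mul_pow]
  ring

/-- The reflection in the hyperplane orthogonal to ξ - ξ' exchanges the two vectors, and both f and
χ are invariant under it. -/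
theorem innerMoment_eq_of_norm_eq {d : ℕ} {f : Distr d} (hrad : IsRadial f) {χ : Test d}
    (hχ : ∀ (A : E d ≃ₗᵢ[ℝ] E d) x, χ (A x) = χ x) {ξ ξ' : E d} (h : ‖ξ‖ = ‖ξ'‖) (η : E d)
    (k j : ℕ) : innerMoment f χ ξ η k 0 j = innerMoment f χ ξ' η k 0 j := by
  have hA := Submodule.reflection_sub h
  set A := (ℝ ∙ (ξ - ξ'))ᗮ.reflection with hAdef
  refine (hrad A _ _ fun x => ?_).symm
  · change χ x * (inner ℝ ξ' x ^ k * inner ℝ η x ^ 0 * (‖x‖ ^ 2) ^ j) =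
      χ (A x) * (inner ℝ ξ (A x) ^ k * inner ℝ η (A x) ^ 0 * (‖A x‖ ^ 2) ^ j)
    have : inner ℝ ξ (A x) = inner ℝ ξ' x := by
      rw [← hA, ← A.inner_map_map ξ (A x), hAdef, Submodule.reflection_reflection]
    rw [hχ, A.norm_map, this, pow_zero, pow_zero]

theorem innerMoment_odd {d : ℕ} {f : Distr d} (hrad : IsRadial f) {χ : Test d}
    (hχ : ∀ (A : E d ≃ₗᵢ[ℝ] E d) x, χ (A x) = χ x) (ξ η : E d) (n j : ℕ) :
    innerMoment f χ ξ η (2 * n + 1) 0 j = 0 := by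
  have h1 := innerMoment_smul f χ ξ η (2 * n + 1) 0 j (-1)
  rw [innerMoment_eq_of_norm_eq hrad hχ (by simp : ‖(-1 : ℝ) • ξ‖ = ‖ξ‖), pow_succ, pow_mul] at h1
  norm_num at h1
  linear_combination h1 / 2

theorem innerMoment_eq_norm_pow_mul {d : ℕ} {f : Distr d} (hrad : IsRadial f) {χ : Test d}
    (hχ : ∀ (A : E d ≃ₗᵢ[ℝ] E d) x, χ (A x) = χ x) (ξ η : E d) {e : E d} (he : ‖e‖ = 1)
    (k j : ℕ) :
    innerMoment f χ ξ η k 0 j = (‖ξ‖ : ℂ) ^ k * innerMoment f χ e η k 0 j := by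
  rw [← innerMoment_smul]
  exact innerMoment_eq_of_norm_eq hrad hχ (by simp [norm_smul, he]) η k j

theorem innerMoment_add_smul {d : ℕ} (f : Distr d) (χ : Test d) (e e' : E d) (m j : ℕ) (b : ℝ) :
    innerMoment f χ (e + b • e') e' m 0 j =
      ∑ k ∈ Finset.range (m + 1), (m.choose k : ℂ) * innerMoment f χ e e' (m - k) k j *
        (b : ℂ) ^ k := by
  have : mulTest χ _ (contDiff_inner_pow (e + b • e') e' m 0 j) =
      ∑ k ∈ Finset.range (m + 1), ((m.choose k : ℝ) * b ^ k) •
        mulTest χ _ (contDiff_inner_pow e e' (m - k) k j) := by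
    ext x
    rw [FunLike.coe_sum, Finset.sum_apply]
    change χ x * (inner ℝ (e + b • e') x ^ m * inner ℝ e' x ^ 0 * (‖x‖ ^ 2) ^ j) =
      ∑ k ∈ Finset.range (m + 1), ((m.choose k : ℝ) * b ^ k) *
        (χ x * (inner ℝ e x ^ (m - k) * inner ℝ e' x ^ k * (‖x‖ ^ 2) ^ j))
    rw [inner_add_left, real_inner_smul_left, add_comm, add_pow, pow_zero, mul_one,
      Finset.sum_mul, Finset.mul_sum]
    refine Finset.sum_congr rfl fun k _ => ?_
    rw [mul_pow]
    ring
  rw [innerMoment, this, map_sum]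
  refine Finset.sum_congr rfl fun k _ => ?_
  rw [map_smul, Complex.real_smul, ← innerMoment]
  push_cast
  ring

/-- The moment of order 2n+2 along e + b e' is (1+b²)^{n+1} times the one along e, since |e + b e'|²
= 1 + b². Both sides are polynomials in b. Comparing coefficients of b² gives C(2n+2, 2) =
(n+1)(2n+1) against n+1. -/
theorem innerMoment_two {d : ℕ} {f : Distr d} (hrad : IsRadial f) {χ : Test d}
    (hχ : ∀ (A : E d ≃ₗᵢ[ℝ] E d) x, χ (A x) = χ x) {e e' : E d} (he : ‖e‖ = 1) (he' : ‖e'‖ = 1)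
    (hee : inner ℝ e e' = 0) (n j : ℕ) :
    (2 * n + 1 : ℂ) * innerMoment f χ e e' (2 * n) 2 j =
      innerMoment f χ e e' (2 * n + 2) 0 j := by
  obtain ⟨I, hI⟩ : ∃ I, I = innerMoment f χ e e' (2 * n + 2) 0 j := ⟨_, rfl⟩
  let P : Polynomial ℂ := ∑ k ∈ Finset.range (2 * n + 2 + 1),
    Polynomial.C (((2 * n + 2).choose k : ℂ) * innerMoment f χ e e' (2 * n + 2 - k) k j) *
      Polynomial.X ^ k
  let Q : Polynomial ℂ := Polynomial.C I * Polynomial.expand ℂ 2 ((1 + Polynomial.X) ^ (n + 1))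
  have hPQ : P = Q := by
    refine Polynomial.eq_of_infinite_eval_eq P Q
      ((Set.infinite_range_of_injective Complex.ofReal_injective).mono ?_)
    rintro _ ⟨b, rfl⟩
    have h1 : P.eval (b : ℂ) = innerMoment f χ (e + b • e') e' (2 * n + 2) 0 j := by
      simp only [P, innerMoment_add_smul, Polynomial.eval_finsetSum, Polynomial.eval_mul,
        Polynomial.eval_C, Polynomial.eval_pow, Polynomial.eval_X]
    have hnorm : ‖e + b • e'‖ ^ 2 = 1 + b ^ 2 := by
      rw [norm_add_sq_real, real_inner_smul_right, hee, norm_smul, he, he']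
      simp
    have h2 : Q.eval (b : ℂ) = (‖e + b • e'‖ : ℂ) ^ (2 * n + 2) * I := by
      rw [show 2 * n + 2 = 2 * (n + 1) by ring, pow_mul, ← Complex.ofReal_pow, hnorm]
      simp [Q, mul_comm]
    change P.eval (b : ℂ) = Q.eval (b : ℂ)
    rw [h1, h2, hI]
    exact innerMoment_eq_norm_pow_mul hrad hχ _ _ he _ _
  have hc := congrArg (fun p => Polynomial.coeff p 2) hPQ
  have hQ : Q.coeff 2 = I * (n + 1) := by
    simp only [Q, Polynomial.coeff_C_mul]
    rw [Polynomial.coeff_expand two_pos]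
    simp [Polynomial.coeff_one_add_X_pow]
  have hP : P.coeff 2 = ((2 * n + 2).choose 2 : ℂ) * innerMoment f χ e e' (2 * n) 2 j := by
    simp only [P, Polynomial.finsetSum_coeff, Polynomial.coeff_C_mul_X_pow]
    rw [Finset.sum_eq_single 2]
    · simp
    · intro k _ hk
      rw [if_neg hk.symm]
    · intro h
      exact absurd (Finset.mem_range.2 (by omega)) h
  have hch : ((2 * n + 2).choose 2 : ℂ) = (n + 1) * (2 * n + 1) := by
    rw [Nat.cast_choose_two]
    push_cast
    ring
  simp only [hQ, hP, hch] at hc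
  have hn : (n + 1 : ℂ) ≠ 0 := by exact_mod_cast Nat.succ_ne_zero n
  rw [← hI]
  exact mul_left_cancel₀ hn (by linear_combination hc)

theorem innerMoment_right_zero {d : ℕ} (f : Distr d) (χ : Test d) (ξ η η' : E d) (k j : ℕ) :
    innerMoment f χ ξ η k 0 j = innerMoment f χ ξ η' k 0 j := rfl

/-- Write one factor |x|² as the sum of the squared coordinates. After multiplication by 2n+1, the
coordinate i₀ contributes 2n+1 copies of the right-hand moment and each of the d-1 others
contributes one. -/
theorem innerMoment_succ {d : ℕ} {f : Distr d} (hrad : IsRadial f) {χ : Test d}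
    (hχ : ∀ (A : E d ≃ₗᵢ[ℝ] E d) x, χ (A x) = χ x) (i₀ : Fin d) (n j : ℕ) :
    (2 * n + 1 : ℂ) * innerMoment f χ (EuclideanSpace.single i₀ 1) 0 (2 * n) 0 (j + 1) =
      (2 * n + d) * innerMoment f χ (EuclideanSpace.single i₀ 1) 0 (2 * n + 2) 0 j := by
  let e : Fin d → E d := fun i => EuclideanSpace.single i 1
  have he : ∀ i, ‖e i‖ = 1 := fun i => by simp [e]
  have hsplit : innerMoment f χ (e i₀) 0 (2 * n) 0 (j + 1) =
      ∑ i, innerMoment f χ (e i₀) (e i) (2 * n) 2 j := by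
    simp only [innerMoment]
    rw [← map_sum]
    congr 1
    ext x
    rw [FunLike.coe_sum, Finset.sum_apply]
    change χ x * (inner ℝ (e i₀) x ^ (2 * n) * inner ℝ (0 : E d) x ^ 0 * (‖x‖ ^ 2) ^ (j + 1)) =
      ∑ i, χ x * (inner ℝ (e i₀) x ^ (2 * n) * inner ℝ (e i) x ^ 2 * (‖x‖ ^ 2) ^ j)
    have hx : ‖x‖ ^ 2 = ∑ i, inner ℝ (e i) x ^ 2 := by
      rw [EuclideanSpace.real_norm_sq_eq]
      simp [e, EuclideanSpace.inner_single_left]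
    rw [pow_succ (‖x‖ ^ 2) j]
    nth_rewrite 2 [hx]
    rw [Finset.mul_sum, Finset.mul_sum, Finset.mul_sum]
    refine Finset.sum_congr rfl fun i _ => ?_
    ring
  have hself : innerMoment f χ (e i₀) (e i₀) (2 * n) 2 j =
      innerMoment f χ (e i₀) 0 (2 * n + 2) 0 j := by
    simp only [innerMoment]
    congr 1
    ext x
    change χ x * (inner ℝ (e i₀) x ^ (2 * n) * inner ℝ (e i₀) x ^ 2 * (‖x‖ ^ 2) ^ j) =
      χ x * (inner ℝ (e i₀) x ^ (2 * n + 2) * inner ℝ (0 : E d) x ^ 0 * (‖x‖ ^ 2) ^ j)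
    ring
  have hne : ∀ i, i ≠ i₀ → (2 * n + 1 : ℂ) * innerMoment f χ (e i₀) (e i) (2 * n) 2 j =
      innerMoment f χ (e i₀) 0 (2 * n + 2) 0 j := by
    intro i hi
    refine (innerMoment_two hrad hχ (he i₀) (he i) ?_ n j).trans
      (innerMoment_right_zero f χ _ _ _ _ _)
    simp [e, EuclideanSpace.inner_single_left, hi]
  change (2 * n + 1 : ℂ) * innerMoment f χ (e i₀) 0 (2 * n) 0 (j + 1) =
    (2 * n + d) * innerMoment f χ (e i₀) 0 (2 * n + 2) 0 j
  rw [hsplit, Finset.mul_sum, ← Finset.add_sum_erase _ _ (Finset.mem_univ i₀), hself,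
    Finset.sum_congr rfl fun i hi => hne i (Finset.ne_of_mem_erase hi), Finset.sum_const,
    Finset.card_erase_of_mem (Finset.mem_univ i₀), Finset.card_univ, Fintype.card_fin,
    nsmul_eq_mul, Nat.cast_sub (Nat.one_le_iff_ne_zero.2 (Fin.pos i₀).ne')]
  push_cast
  ring

/-- Iterating `innerMoment_succ` trades all powers of the coordinate for powers of |x|². The ratio
(1/2)_n / (d/2)_n is the mean of ω₁^{2n} over the unit sphere. -/
theorem ascPochhammer_mul_innerMoment {d : ℕ} {f : Distr d} (hrad : IsRadial f) {χ : Test d}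
    (hχ : ∀ (A : E d ≃ₗᵢ[ℝ] E d) x, χ (A x) = χ x) (i₀ : Fin d) (n : ℕ) : ∀ j : ℕ,
    (((ascPochhammer ℝ n).eval ((d : ℝ) / 2) : ℝ) : ℂ) *
      innerMoment f χ (EuclideanSpace.single i₀ 1) 0 (2 * n) 0 j =
    (((ascPochhammer ℝ n).eval (1 / 2 : ℝ) : ℝ) : ℂ) *
      innerMoment f χ (EuclideanSpace.single i₀ 1) 0 0 0 (n + j) := by
  induction n with
  | zero => intro j; simp
  | succ n ih =>
    intro j
    have h1 := innerMoment_succ hrad hχ i₀ n j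
    have h2 := ih (j + 1)
    rw [ascPochhammer_succ_eval, ascPochhammer_succ_eval, show 2 * (n + 1) = 2 * n + 2 by ring,
      show n + 1 + j = n + (j + 1) by ring]
    push_cast at h1 h2 ⊢
    linear_combination (1 / 2 + (n : ℂ)) * h2 -
      (((ascPochhammer ℝ n).eval ((d : ℝ) / 2) : ℝ) : ℂ) / 2 * h1

theorem ascPochhammer_half_mul (n : ℕ) :
    (ascPochhammer ℝ n).eval (1 / 2 : ℝ) * (4 ^ n * n.factorial) = ((2 * n).factorial : ℝ) := by
  induction n with
  | zero => simp
  | succ n ih =>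
    rw [ascPochhammer_succ_eval, show 2 * (n + 1) = 2 * n + 1 + 1 by ring, Nat.factorial_succ (2 * n + 1),
      Nat.factorial_succ (2 * n), Nat.factorial_succ n]
    push_cast
    rw [← ih]
    ring

/-! ### Power series of the Fourier transform -/

/-- The pairing `⟨f, χ(x) |x|^{2n}⟩`. -/
def evenMoment {d : ℕ} (f : Distr d) (χ : Test d) (n : ℕ) : ℂ :=
  f (mulTest χ (fun x => (‖x‖ ^ 2) ^ n) ((contDiff_norm_sq ℝ).pow n))

/-- The power series of the Fourier transform of a radial distribution. -/
theorem hasSum_fourier {d : ℕ} (hd : 0 < d) {f : Distr d}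
    (hf : IsCompact (Distribution.dsupport f)) (hrad : IsRadial f) {χ : Test d}
    (hχ : IsCutoff f χ) (hχr : ∀ (A : E d ≃ₗᵢ[ℝ] E d) x, χ (A x) = χ x) (ξ : E d) :
    HasSum (fun n : ℕ => (-1 : ℂ) ^ n * ((‖ξ‖ : ℂ) ^ 2) ^ n /
      (4 ^ n * n.factorial * (((ascPochhammer ℝ n).eval ((d : ℝ) / 2) : ℝ) : ℂ)) *
        evenMoment f χ n) (fourier f hf ξ) := by
  have hp : ContDiff ℝ ∞ (fun x : E d => inner ℝ ξ x) := contDiff_const.inner ℝ contDiff_id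
  have h := hasSum_pairing f hf χ hχ hp (fun k => (-Complex.I) ^ k / k.factorial)
    (fun M _ => by
      refine (Real.summable_pow_div_factorial M).congr fun n => ?_
      simp
      ring)
    _ (contDiff_expFun ξ) (fun x => by
      rw [Complex.exp_eq_exp_ℂ]
      refine (NormedSpace.expSeries_div_hasSum_exp
        (-Complex.I * ((inner ℝ ξ x : ℝ) : ℂ))).congr_fun fun n => ?_
      ring)
  have hinj : Function.Injective (fun n : ℕ => 2 * n) := fun a b h => by
    simpa using h
  have h0 : ∀ k, f (mulTest χ (fun x => inner ℝ ξ x ^ k) (hp.pow k)) =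
      innerMoment f χ ξ 0 k 0 0 := by
    intro k
    rw [innerMoment]
    congr 1
    ext x
    change χ x * inner ℝ ξ x ^ k =
      χ x * (inner ℝ ξ x ^ k * inner ℝ (0 : E d) x ^ 0 * (‖x‖ ^ 2) ^ 0)
    ring
  -- Only even k survive; the side goal for odd k is closed by `innerMoment_odd`.
  rw [← hinj.hasSum_iff] at h
  · refine h.congr_fun fun n => ?_
    have i₀ : Fin d := ⟨0, hd⟩
    have hpos : 0 < (ascPochhammer ℝ n).eval ((d : ℝ) / 2) :=
      ascPochhammer_pos n _ (by positivity)
    have h1 := ascPochhammer_mul_innerMoment hrad hχr i₀ n 0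
    have h2 : innerMoment f χ (EuclideanSpace.single i₀ 1) 0 0 0 (n + 0) = evenMoment f χ n := by
      rw [innerMoment, evenMoment]
      congr 1
      ext x
      change χ x * (inner ℝ (EuclideanSpace.single i₀ 1 : E d) x ^ 0 *
        inner ℝ (0 : E d) x ^ 0 * (‖x‖ ^ 2) ^ (n + 0)) = χ x * (‖x‖ ^ 2) ^ n
      simp
    rw [h2] at h1
    have h3 : ((((ascPochhammer ℝ n).eval (1 / 2 : ℝ) : ℝ) : ℂ)) * (4 ^ n * n.factorial) =
        (2 * n).factorial := by
      have := congrArg (fun r : ℝ => (r : ℂ)) (ascPochhammer_half_mul n)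
      push_cast at this ⊢
      exact this
    have hpos' : (((ascPochhammer ℝ n).eval ((d : ℝ) / 2) : ℝ) : ℂ) ≠ 0 := by
      exact_mod_cast hpos.ne'
    have hfac : ((2 * n).factorial : ℂ) ≠ 0 := by exact_mod_cast (Nat.factorial_pos _).ne'
    have hfac' : (n.factorial : ℂ) ≠ 0 := by exact_mod_cast (Nat.factorial_pos _).ne'
    simp only [Function.comp_apply]
    rw [h0, innerMoment_eq_norm_pow_mul hrad hχr ξ 0
      (show ‖(EuclideanSpace.single i₀ 1 : E d)‖ = 1 by simp)]
    rw [pow_mul (-Complex.I), neg_sq, Complex.I_sq, pow_mul]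
    have h4 : innerMoment f χ (EuclideanSpace.single i₀ 1) 0 (2 * n) 0 0 =
        (2 * n).factorial / (4 ^ n * n.factorial) * evenMoment f χ n /
          (((ascPochhammer ℝ n).eval ((d : ℝ) / 2) : ℝ) : ℂ) := by
      rw [eq_div_iff hpos', ← h3, mul_comm, h1]
      field_simp
    rw [h4]
    field_simp
  · intro k hk
    obtain ⟨n, rfl⟩ : ∃ n, k = 2 * n + 1 := by
      rcases Nat.even_or_odd' k with ⟨n, rfl | rfl⟩
      · exact absurd ⟨n, rfl⟩ hk
      · exact ⟨n, rfl⟩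
    rw [h0, innerMoment_odd hrad hχr, mul_zero]

/-! ### Power series of φ_ℓ² -/

theorem descPochhammer_mul_Gamma {x : ℝ} (hx : -1 < x) (i : ℕ) :
    (descPochhammer ℝ i).eval (x + i) * Real.Gamma (x + 1) = Real.Gamma (x + i + 1) := by
  have h := Gamma_add_nat (x + 1) (by linarith) i
  rw [descPochhammer_eval_eq_ascPochhammer, show x + i - i + 1 = x + 1 by ring, ← h]
  congr 1
  ring

/-- This is Vandermonde's identity for falling factorials of (μ+n) + (μ+n), divided by n! Γ(μ+n+1)².
Since 2μ is the integer k, the total is an ordinary binomial coefficient although μ may be a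
half-integer. -/
theorem sum_antidiagonal_inv_Gamma {μ : ℝ} (hμ : 0 ≤ μ) {k : ℕ} (hk : 2 * μ = k) (n : ℕ) :
    ∑ p ∈ Finset.HasAntidiagonal.antidiagonal n, (1 / (p.1.factorial * Real.Gamma (μ + p.1 + 1))) *
      (1 / (p.2.factorial * Real.Gamma (μ + p.2 + 1))) =
    ((k + 2 * n).choose n : ℝ) / Real.Gamma (μ + n + 1) ^ 2 := by
  have hpos : ∀ m : ℕ, 0 < Real.Gamma (μ + m + 1) := fun m =>
    Real.Gamma_pos_of_pos (by positivity)
  have hV := descPochhammer_vandermonde (μ + n) (μ + n) n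
  rw [show μ + n + (μ + n) = ((k + 2 * n : ℕ) : ℝ) by push_cast; rw [← hk]; ring,
    descPochhammer_eval_eq_descFactorial, Nat.descFactorial_eq_factorial_mul_choose] at hV
  have hn : (n.factorial : ℝ) ≠ 0 := by exact_mod_cast n.factorial_ne_zero
  rw [eq_div_iff (pow_ne_zero 2 (hpos n).ne')]
  refine mul_left_cancel₀ hn ?_
  rw [Nat.cast_mul] at hV
  rw [hV, Finset.Nat.sum_antidiagonal_eq_sum_range_succ_mk, Finset.sum_mul, Finset.mul_sum]
  refine Finset.sum_congr rfl fun i hi => ?_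
  have hi' : i ≤ n := Nat.lt_succ_iff.1 (Finset.mem_range.1 hi)
  obtain ⟨j, rfl⟩ := Nat.exists_eq_add_of_le hi'
  have h1 := descPochhammer_mul_Gamma (x := μ + j) (by linarith [Nat.cast_nonneg (α := ℝ) j]) i
  have h2 := descPochhammer_mul_Gamma (x := μ + i) (by linarith [Nat.cast_nonneg (α := ℝ) i]) j
  have e1 : μ + j + i = μ + ((i + j : ℕ) : ℝ) := by push_cast; ring
  have e2 : μ + i + j = μ + ((i + j : ℕ) : ℝ) := by push_cast; ring
  rw [e1] at h1
  rw [e2] at h2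
  have hc : ((i + j).choose i : ℝ) * (i.factorial * j.factorial) = (i + j).factorial := by
    have := Nat.choose_mul_factorial_mul_factorial hi'
    rw [Nat.add_sub_cancel_left] at this
    rw [← this]
    push_cast
    ring
  have hi0 : (i.factorial : ℝ) ≠ 0 := by exact_mod_cast i.factorial_ne_zero
  have hj0 : (j.factorial : ℝ) ≠ 0 := by exact_mod_cast j.factorial_ne_zero
  have hgi := (hpos i).ne'
  have hgj := (hpos j).ne'
  rw [Nat.add_sub_cancel_left, pow_two]
  nth_rewrite 1 [← h1]
  rw [← h2, ← hc]
  field_simp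

/-- The coefficient of `κ^n r^{2n}` in the power series of `φ_ℓ(√κ r)²`, where `d = c + 2`. -/
def phiSqCoeff (c ℓ n : ℕ) : ℝ :=
  (-1) ^ (n + ℓ) * ((2 * n + c).choose (n + ℓ + c) : ℝ) /
    (4 ^ n * 2 ^ c * Real.Gamma ((c : ℝ) / 2 + 1 + n) ^ 2)

theorem hasSum_phi_sq (c ℓ : ℕ) {z w : ℂ} (hz : z ^ 2 = w) :
    HasSum (fun n : ℕ => (phiSqCoeff c ℓ n : ℂ) * w ^ n) (phi (c + 2) ℓ z ^ 2) := by
  have hnu : nu (c + 2) = (c : ℝ) / 2 := by simp [nu]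
  obtain ⟨μ, hμ⟩ : ∃ μ : ℝ, μ = (ℓ : ℝ) + nu (c + 2) := ⟨_, rfl⟩
  have hμ' : μ = (ℓ : ℝ) + (c : ℝ) / 2 := by rw [hμ, hnu]
  have hμ0 : 0 ≤ μ := by rw [hμ']; positivity
  let t : ℕ → ℂ := fun n => (-1 : ℂ) ^ n /
    ((n.factorial : ℂ) * ((Real.Gamma (μ + (n : ℝ) + 1) : ℝ) : ℂ)) * (z / 2) ^ (2 * n)
  have ht : Summable fun n => ‖t n‖ := by
    obtain ⟨C, hC⟩ := inv_gamma_bounded (c + 2) ℓ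
    rw [← hμ] at hC
    refine ((Real.summable_pow_div_factorial (‖z / 2‖ ^ 2)).mul_left C).of_nonneg_of_le
      (fun n => norm_nonneg _) fun n => ?_
    have e : ‖t n‖ = |(Real.Gamma (μ + (n : ℝ) + 1))⁻¹| * ((‖z / 2‖ ^ 2) ^ n / n.factorial) := by
      simp only [t, norm_div, norm_mul, norm_pow, norm_neg, norm_one, one_pow,
        Complex.norm_natCast, Complex.norm_real, abs_inv, Real.norm_eq_abs, pow_mul]
      rw [one_div, mul_inv]
      ring
    rw [e]
    gcongr
    exact hC n
  have hsq : HasSum (fun n => ∑ p ∈ Finset.HasAntidiagonal.antidiagonal n, t p.1 * t p.2)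
      ((∑' n, t n) * ∑' n, t n) := by
    rw [tsum_mul_tsum_eq_tsum_sum_antidiagonal_of_summable_norm ht ht]
    exact (summable_norm_sum_mul_antidiagonal_of_summable_norm ht ht).of_norm.hasSum
  have hterm : ∀ n, ∑ p ∈ Finset.HasAntidiagonal.antidiagonal n, t p.1 * t p.2 =
      (-1) ^ n * (((2 * ℓ + c + 2 * n).choose n : ℝ) / Real.Gamma (μ + n + 1) ^ 2 : ℝ) *
        (w / 4) ^ n := by
    intro n
    rw [← sum_antidiagonal_inv_Gamma hμ0 (k := 2 * ℓ + c) (by rw [hμ']; push_cast; ring) n]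
    push_cast
    rw [Finset.mul_sum, Finset.sum_mul]
    refine Finset.sum_congr rfl fun p hp => ?_
    have hp' := Finset.HasAntidiagonal.mem_antidiagonal.1 hp
    have e : (z / 2) ^ 2 = w / 4 := by rw [div_pow, hz]; norm_num
    simp only [t]
    rw [← hp', pow_mul, pow_mul, e, pow_add, pow_add]
    ring
  have hphi : phi (c + 2) ℓ z ^ 2 = w ^ ℓ / (4 ^ ℓ * 2 ^ c) * ((∑' n, t n) * ∑' n, t n) := by
    have h2 : ((((2 : ℝ) ^ μ : ℝ) : ℂ)) ^ 2 = 4 ^ ℓ * 2 ^ c := by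
      rw [← Complex.ofReal_pow, ← Real.rpow_natCast, ← Real.rpow_mul (by norm_num),
        show μ * ((2 : ℕ) : ℝ) = ((2 * ℓ + c : ℕ) : ℝ) by rw [hμ']; push_cast; ring,
        Real.rpow_natCast, pow_add, pow_mul]
      push_cast
      norm_num
    unfold phi
    rw [← hμ, mul_pow, div_pow, ← pow_mul, mul_comm ℓ 2, pow_mul, hz, h2, ← sq]
  -- The prefactor w^ℓ shifts the Cauchy product by ℓ; the missing terms n < ℓ have a vanishing
  -- binomial in `phiSqCoeff`.
  have hinj : Function.Injective (fun m : ℕ => ℓ + m) := fun a b h => by simpa using h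
  rw [hphi, ← hinj.hasSum_iff]
  · refine (hsq.mul_left (w ^ ℓ / (4 ^ ℓ * 2 ^ c))).congr_fun fun m => ?_
    have hG : Real.Gamma ((c : ℝ) / 2 + 1 + ((ℓ + m : ℕ) : ℝ)) = Real.Gamma (μ + m + 1) := by
      congr 1
      rw [hμ']
      push_cast
      ring
    have hch : (2 * (ℓ + m) + c).choose (ℓ + m + ℓ + c) = (2 * ℓ + c + 2 * m).choose m := by
      rw [show 2 * (ℓ + m) + c = 2 * ℓ + c + 2 * m by ring]
      exact Nat.choose_symm_of_eq_add (by ring)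
    have hs : (-1 : ℝ) ^ (ℓ + m + ℓ) = (-1) ^ m := by
      rw [show ℓ + m + ℓ = 2 * ℓ + m by ring, pow_add, pow_mul]
      norm_num
    simp only [Function.comp_apply, phiSqCoeff]
    rw [hterm, hG, hch, hs]
    push_cast
    have h3 : ((Real.Gamma (μ + m + 1) : ℝ) : ℂ) ≠ 0 := by
      exact_mod_cast (Real.Gamma_pos_of_pos (by positivity)).ne'
    rw [pow_add, pow_add, div_pow]
    field_simp
  · intro n hn
    have hlt : n < ℓ := by
      by_contra h
      exact hn ⟨n - ℓ, by dsimp only; omega⟩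
    simp [phiSqCoeff, Nat.choose_eq_zero_of_lt (show 2 * n + c < n + ℓ + c by omega)]

/-! ### Zonal functions in powers of u and their inversion -/

/-- The integers `C(ℓ+j+c, 2j+c) + C(ℓ+j+c-1, 2j+c)` (without the second term if `ℓ = 0`), which
appear in the expansion of `N_{ℓ,d} P_{ℓ,d}` in powers of `1 - t`, where `d = c + 2`. -/
def zonalCoeff (c j : ℕ) : ℕ → ℕ
  | 0 => (j + c).choose (2 * j + c)
  | ℓ + 1 => (ℓ + 1 + j + c).choose (2 * j + c) + (ℓ + j + c).choose (2 * j + c)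

theorem sub_mul_choose_succ (N k : ℕ) :
    ((N : ℝ) + 1 - k) * ((N + 1).choose k : ℝ) = ((N : ℝ) + 1) * (N.choose k : ℝ) := by
  rcases le_or_gt k N with h | h
  · have := Nat.choose_mul_succ_eq N k
    have h2 : ((N + 1 - k : ℕ) : ℝ) = (N : ℝ) + 1 - k := by
      rw [Nat.cast_sub (by omega)]; push_cast; ring
    rw [← h2]
    have h3 : ((N.choose k * (N + 1) : ℕ) : ℝ) = (((N + 1).choose k * (N + 1 - k) : ℕ) : ℝ) := by
      rw [this]
    push_cast at h3
    linarith
  · rw [Nat.choose_eq_zero_of_lt h]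
    rcases Nat.lt_or_ge (N + 1) k with h' | h'
    · rw [Nat.choose_eq_zero_of_lt h']; simp
    · have : k = N + 1 := by omega
      subst this
      push_cast
      ring

theorem sub_mul_choose (N k : ℕ) :
    ((N : ℝ) - k) * (N.choose k : ℝ) = ((k : ℝ) + 1) * (N.choose (k + 1) : ℝ) := by
  rcases le_or_gt k N with h | h
  · have h3 : ((N.choose (k + 1) * (k + 1) : ℕ) : ℝ) = ((N.choose k * (N - k) : ℕ) : ℝ) := by
      rw [Nat.choose_succ_right_eq]
    push_cast [Nat.cast_sub h] at h3
    linarith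
  · rw [Nat.choose_eq_zero_of_lt h, Nat.choose_eq_zero_of_lt (by omega)]; simp

/-- The factor n - j makes the sum telescope, so every partial sum has a closed form. The factor n -
L on the right makes it vanish at L = n. -/
theorem sub_mul_sum_zonalCoeff (c n j L : ℕ) :
    ((n : ℝ) - j) * ∑ ℓ ∈ Finset.range (L + 1),
      (-1 : ℝ) ^ ℓ * ((2 * n + c).choose (n + ℓ + c) : ℝ) * (zonalCoeff c j ℓ : ℝ) =
    (-1) ^ L * ((n : ℝ) - L) * ((2 * n + c).choose (n + L + c) : ℝ) *
      ((L + j + c).choose (2 * j + c) : ℝ) := by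
  induction L with
  | zero =>
    rcases Nat.eq_zero_or_pos j with rfl | hj
    · simp [zonalCoeff]
    · simp [zonalCoeff, Nat.choose_eq_zero_of_lt (show j + c < 2 * j + c by omega)]
  | succ L ih =>
    rw [Finset.sum_range_succ, mul_add, ih]
    have h1 := sub_mul_choose (2 * n + c) (n + L + c)
    have h2 := sub_mul_choose_succ (L + j + c) (2 * j + c)
    rw [show L + j + c + 1 = L + 1 + j + c by ring] at h2
    rw [show n + L + c + 1 = n + (L + 1) + c by ring] at h1
    simp only [zonalCoeff]
    push_cast at h1 h2 ⊢
    linear_combination (-1 : ℝ) ^ L * ((L + j + c).choose (2 * j + c) : ℝ) * h1 -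
      (-1 : ℝ) ^ L * ((2 * n + c).choose (n + (L + 1) + c) : ℝ) * h2

theorem zonalCoeff_eq_zero {c j ℓ : ℕ} (h : ℓ < j) : zonalCoeff c j ℓ = 0 := by
  cases ℓ with
  | zero => exact Nat.choose_eq_zero_of_lt (by omega)
  | succ ℓ =>
    rw [zonalCoeff, Nat.choose_eq_zero_of_lt (by omega), Nat.choose_eq_zero_of_lt (by omega)]

theorem zonalCoeff_self (c j : ℕ) : zonalCoeff c j j = 1 := by
  cases j with
  | zero => simp [zonalCoeff]
  | succ j =>
    rw [zonalCoeff, show j + 1 + (j + 1) + c = 2 * (j + 1) + c by ring, Nat.choose_self,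
      Nat.choose_eq_zero_of_lt (by omega)]

/-- For j ≠ n, divide the telescoped identity at L = n by n - j. For j = n that identity is void,
but triangularity leaves only the term ℓ = n. -/
theorem sum_zonalCoeff (c n j : ℕ) :
    ∑ ℓ ∈ Finset.range (n + 1),
      (-1 : ℝ) ^ ℓ * ((2 * n + c).choose (n + ℓ + c) : ℝ) * (zonalCoeff c j ℓ : ℝ) =
    if j = n then (-1) ^ n else 0 := by
  split_ifs with h
  · subst h
    rw [Finset.sum_range_succ, Finset.sum_eq_zero, zonalCoeff_self]
    · simp [show j + j + c = 2 * j + c by ring]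
    · intro ℓ hℓ
      rw [zonalCoeff_eq_zero (Finset.mem_range.1 hℓ)]
      simp
  · have h1 := sub_mul_sum_zonalCoeff c n j n
    rw [sub_self, mul_zero, zero_mul, zero_mul] at h1
    refine (mul_eq_zero.1 h1).resolve_left (sub_ne_zero.2 ?_)
    exact_mod_cast Ne.symm h

theorem ascPochhammer_duplication (c j : ℕ) :
    4 ^ j * (ascPochhammer ℝ j).eval (((c : ℝ) + 1) / 2) *
      (ascPochhammer ℝ j).eval ((c : ℝ) / 2 + 1) * c.factorial = (2 * j + c).factorial := by
  induction j with
  | zero => simp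
  | succ j ih =>
    rw [ascPochhammer_succ_eval, ascPochhammer_succ_eval,
      show 2 * (j + 1) + c = 2 * j + c + 1 + 1 by ring, Nat.factorial_succ (2 * j + c + 1),
      Nat.factorial_succ (2 * j + c)]
    push_cast
    rw [← ih]
    ring

theorem ascPochhammer_mul_factorial (m j : ℕ) :
    (ascPochhammer ℝ j).eval ((m : ℝ) + 1) * m.factorial = (m + j).factorial := by
  have := Nat.factorial_mul_ascFactorial m j
  rw [← this, Nat.cast_mul, ← ascPochhammer_nat_eq_natCast_ascFactorial]
  push_cast
  ring

theorem harmonicDim_succ (c ℓ : ℕ) : harmonicDim (c + 2) (ℓ + 1) =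
    ((ℓ + 1 + c).choose c : ℝ) + ((ℓ + c).choose c : ℝ) := by
  rw [harmonicDim, show ℓ + 1 + (c + 2) - 1 = ℓ + c + 1 + 1 by omega,
    show c + 2 - 1 = c + 1 by omega, show ℓ + 1 + (c + 2) - 3 = ℓ + c by omega,
    Nat.choose_succ_succ, Nat.choose_succ_succ, show ℓ + 1 + c = ℓ + c + 1 by ring]
  push_cast
  ring

theorem harmonicDim_zero (c : ℕ) : harmonicDim (c + 2) 0 = 1 := by
  rw [harmonicDim, show 0 + (c + 2) - 1 = c + 1 by omega,
    show c + 2 - 1 = c + 1 by omega, Nat.choose_self, Nat.choose_eq_zero_of_lt (by omega)]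
  simp

/-- Both N_ℓ and `zonalCoeff` are sums of two neighbouring binomials. Once all is written in
factorials, with m the difference of degree and j, the claim reduces to degree = j + m. -/
theorem harmonicDim_mul_choose_mul (c j ℓ : ℕ) (hj : j ≤ ℓ) :
    harmonicDim (c + 2) ℓ * ((ℓ.choose j : ℝ) * (ascPochhammer ℝ j).eval ((ℓ : ℝ) + c)) *
      (j.factorial * c.factorial) = (2 * j + c).factorial * (zonalCoeff c j ℓ : ℝ) := by
  cases ℓ with
  | zero =>
    obtain rfl : j = 0 := by omega
    simp [harmonicDim_zero, zonalCoeff]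
  | succ ℓ =>
    obtain ⟨m, hm⟩ := Nat.exists_eq_add_of_le hj
    have hA := ascPochhammer_mul_factorial (ℓ + c) j
    have h1 : ((ℓ + 1 + c).choose c : ℝ) * ((ℓ + 1).factorial * c.factorial) =
        (ℓ + 1 + c).factorial := by
      have := Nat.add_choose_mul_factorial_mul_factorial (ℓ + 1) c
      rw [← this]; push_cast; ring
    have h2 : ((ℓ + c).choose c : ℝ) * (ℓ.factorial * c.factorial) = (ℓ + c).factorial := by
      have := Nat.add_choose_mul_factorial_mul_factorial ℓ c
      rw [← this]; push_cast; ring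
    have h3 : ((ℓ + 1).choose j : ℝ) * (j.factorial * m.factorial) = (ℓ + 1).factorial := by
      have := Nat.choose_mul_factorial_mul_factorial hj
      rw [show ℓ + 1 - j = m by omega] at this
      rw [← this]; push_cast; ring
    have h4 : ((ℓ + 1 + j + c).choose (2 * j + c) : ℝ) * ((2 * j + c).factorial * m.factorial) =
        (ℓ + 1 + j + c).factorial := by
      have := Nat.choose_mul_factorial_mul_factorial
        (show 2 * j + c ≤ ℓ + 1 + j + c by omega)
      rw [show ℓ + 1 + j + c - (2 * j + c) = m by omega] at this
      rw [← this]; push_cast; ring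
    have h5 := sub_mul_choose_succ (ℓ + j + c) (2 * j + c)
    have hmR : (ℓ : ℝ) + 1 = j + m := by exact_mod_cast hm
    rw [show ℓ + j + c + 1 = ℓ + 1 + j + c by ring] at h5
    rw [harmonicDim_succ, zonalCoeff]
    have f1 : ((ℓ + 1).factorial : ℝ) = (ℓ + 1) * ℓ.factorial := by
      rw [Nat.factorial_succ]; push_cast; ring
    have f2 : ((ℓ + 1 + c).factorial : ℝ) = (ℓ + 1 + c) * (ℓ + c).factorial := by
      rw [show ℓ + 1 + c = ℓ + c + 1 by ring, Nat.factorial_succ]; push_cast; ring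
    have f3 : ((ℓ + 1 + j + c).factorial : ℝ) = (ℓ + 1 + j + c) * (ℓ + c + j).factorial := by
      rw [show ℓ + 1 + j + c = ℓ + c + j + 1 by ring, Nat.factorial_succ]; push_cast; ring
    rw [f1] at h1 h3
    rw [f2] at h1
    rw [f3] at h4
    have p1 : (ℓ.factorial : ℝ) ≠ 0 := by exact_mod_cast ℓ.factorial_ne_zero
    have p2 : (m.factorial : ℝ) ≠ 0 := by exact_mod_cast m.factorial_ne_zero
    have p3 : ((ℓ + c).factorial : ℝ) ≠ 0 := by exact_mod_cast (ℓ + c).factorial_ne_zero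
    have p4 : (ℓ : ℝ) + 1 ≠ 0 := by positivity
    have p5 : (ℓ : ℝ) + 1 + j + c ≠ 0 := by positivity
    have p6 : (c.factorial : ℝ) ≠ 0 := by exact_mod_cast c.factorial_ne_zero
    have p7 : (j.factorial : ℝ) ≠ 0 := by exact_mod_cast j.factorial_ne_zero
    have p8 : ((2 * j + c).factorial : ℝ) ≠ 0 := by exact_mod_cast (2 * j + c).factorial_ne_zero
    have e0 : (ascPochhammer ℝ j).eval ((ℓ : ℝ) + 1 + c) =
        (ℓ + c + j).factorial / (ℓ + c).factorial := by
      rw [eq_div_iff p3, ← hA]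
      push_cast
      ring_nf
    have e1 := eq_div_of_mul_eq (by positivity) h1
    have e2 := eq_div_of_mul_eq (by positivity) h2
    have e3 := eq_div_of_mul_eq (by positivity) h3
    have e4 := eq_div_of_mul_eq (by positivity) h4
    -- Expressing this binomial through its neighbour avoids (m-1)! and so covers m = 0, where it
    -- vanishes.
    have e5 : ((ℓ + j + c).choose (2 * j + c) : ℝ) =
        m * ((ℓ + 1 + j + c).choose (2 * j + c) : ℝ) / (ℓ + 1 + j + c) := by
      rw [eq_div_iff p5]
      push_cast at h5
      linear_combination ((ℓ + 1 + j + c).choose (2 * j + c) : ℝ) * hmR - h5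
    push_cast
    rw [e5, e0, e1, e2, e3, e4]
    field_simp
    linear_combination hmR

/-- Expansion of `N_{ℓ,d} P_{ℓ,d}(1 - 2u)` in powers of `u`, for `d = c + 2`. -/
theorem harmonicDim_mul_aeval_legendre (c ℓ : ℕ) (u : ℂ) :
    (harmonicDim (c + 2) ℓ : ℂ) * Polynomial.aeval (1 - 2 * u) (legendre (c + 2) ℓ) =
    ∑ j ∈ Finset.range (ℓ + 1),
      (((ascPochhammer ℝ j).eval ((c : ℝ) / 2 + 1) / j.factorial * zonalCoeff c j ℓ : ℝ) : ℂ) *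
        (-4 * u) ^ j := by
  rw [legendre, map_sum, Finset.mul_sum]
  refine Finset.sum_congr rfl fun j hj => ?_
  have hj' : j ≤ ℓ := Nat.lt_succ_iff.1 (Finset.mem_range.1 hj)
  have h1 := harmonicDim_mul_choose_mul c j ℓ hj'
  have h2 := ascPochhammer_duplication c j
  have hu : (1 / 2 : ℂ) * (1 - (1 - 2 * u)) = u := by ring
  simp only [map_mul, map_pow, map_sub, map_one, Polynomial.aeval_X, Polynomial.aeval_C,
    Complex.coe_algebraMap]
  have hhalf : (((1 / 2 : ℝ)) : ℂ) = 1 / 2 := by push_cast; rfl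
  rw [hhalf, hu]
  have q1 : (ℓ : ℝ) + ((c + 2 : ℕ) : ℝ) - 2 = ℓ + c := by push_cast; ring
  have q2 : (((c + 2 : ℕ) : ℝ) - 1) / 2 = ((c : ℝ) + 1) / 2 := by push_cast; ring
  rw [q1, q2]
  have p1 : (ascPochhammer ℝ j).eval (((c : ℝ) + 1) / 2) ≠ 0 :=
    (ascPochhammer_pos j _ (by positivity)).ne'
  have p2 : (j.factorial : ℝ) ≠ 0 := by exact_mod_cast j.factorial_ne_zero
  have p3 : (c.factorial : ℝ) ≠ 0 := by exact_mod_cast c.factorial_ne_zero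
  rw [← h2] at h1
  have h3 : harmonicDim (c + 2) ℓ * ((ℓ.choose j : ℝ) * (ascPochhammer ℝ j).eval ((ℓ : ℝ) + c)) *
      j.factorial = 4 ^ j * (ascPochhammer ℝ j).eval (((c : ℝ) + 1) / 2) *
      (ascPochhammer ℝ j).eval ((c : ℝ) / 2 + 1) * (zonalCoeff c j ℓ : ℝ) :=
    mul_right_cancel₀ p3 (by linear_combination h1)
  have h4 : harmonicDim (c + 2) ℓ * ((-1) ^ j * (ℓ.choose j : ℝ) *
      ((ascPochhammer ℝ j).eval ((ℓ : ℝ) + c) /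
        (ascPochhammer ℝ j).eval (((c : ℝ) + 1) / 2))) =
      (ascPochhammer ℝ j).eval ((c : ℝ) / 2 + 1) / j.factorial * zonalCoeff c j ℓ *
        (-4) ^ j := by
    rw [neg_pow 4 j]
    generalize (ascPochhammer ℝ j).eval ((c : ℝ) / 2 + 1) = Q at h3 ⊢
    field_simp
    linear_combination h3
  have h5 := congrArg (fun r : ℝ => (r : ℂ)) h4
  push_cast at h5 ⊢
  rw [mul_pow (-4) u]
  linear_combination u ^ j * h5

/-- In powers of u, the coefficient of index j is a multiple of the sum in `sum_zonalCoeff`, so only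
j = n remains; its sign (-1)^n turns (-4u)^n into (4u)^n. -/
theorem sum_choose_mul_legendre (c n : ℕ) (u : ℂ) :
    ∑ ℓ ∈ Finset.range (n + 1), (-1 : ℂ) ^ ℓ * ((2 * n + c).choose (n + ℓ + c) : ℂ) *
      ((harmonicDim (c + 2) ℓ : ℂ) * Polynomial.aeval (1 - 2 * u) (legendre (c + 2) ℓ)) =
    (((ascPochhammer ℝ n).eval ((c : ℝ) / 2 + 1) : ℝ) : ℂ) / n.factorial * (4 * u) ^ n := by
  have hext : ∀ ℓ ∈ Finset.range (n + 1), (-1 : ℂ) ^ ℓ * ((2 * n + c).choose (n + ℓ + c) : ℂ) *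
      ((harmonicDim (c + 2) ℓ : ℂ) * Polynomial.aeval (1 - 2 * u) (legendre (c + 2) ℓ)) =
      ∑ j ∈ Finset.range (n + 1), (((ascPochhammer ℝ j).eval ((c : ℝ) / 2 + 1) : ℝ) : ℂ) /
        j.factorial * (-4 * u) ^ j * (((-1 : ℝ) ^ ℓ * ((2 * n + c).choose (n + ℓ + c) : ℝ) *
          (zonalCoeff c j ℓ : ℝ) : ℝ) : ℂ) := by
    intro ℓ hℓ
    -- The terms ℓ < j added here are zero; a range independent of ℓ allows the sums to be
    -- exchanged.
    have hsub : Finset.range (ℓ + 1) ⊆ Finset.range (n + 1) :=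
      Finset.range_subset_range.2 (Finset.mem_range.1 hℓ)
    rw [harmonicDim_mul_aeval_legendre, Finset.mul_sum]
    refine Eq.trans (Finset.sum_congr rfl fun j _ => ?_)
      (Finset.sum_subset hsub fun j _ hj => ?_)
    · push_cast
      ring
    · rw [zonalCoeff_eq_zero (by simpa using hj)]
      simp
  rw [Finset.sum_congr rfl hext, Finset.sum_comm]
  simp only [← Finset.mul_sum, ← Complex.ofReal_sum, sum_zonalCoeff]
  rw [Finset.sum_eq_single n]
  · rw [if_pos rfl]
    push_cast
    rw [mul_assoc, ← mul_pow]
    ring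
  · intro j _ hj
    rw [if_neg hj]
    simp
  · intro h
    exact absurd (Finset.mem_range.2 (Nat.lt_succ_self n)) h

/-! ### Growth bounds and the constant (2π)^d / |S^{d-1}|² -/

theorem zonalCoeff_le (c j ℓ : ℕ) : zonalCoeff c j ℓ ≤ 2 ^ (ℓ + j + c + 1) := by
  cases ℓ with
  | zero =>
    refine (Nat.choose_le_two_pow _ _).trans (Nat.pow_le_pow_right two_pos (by omega))
  | succ ℓ =>
    have h1 := Nat.choose_le_two_pow (ℓ + 1 + j + c) (2 * j + c)
    have h2 := (Nat.choose_le_two_pow (ℓ + j + c) (2 * j + c)).trans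
      (Nat.pow_le_pow_right two_pos (show ℓ + j + c ≤ ℓ + 1 + j + c by omega))
    rw [zonalCoeff, pow_succ]
    omega

theorem ascPochhammer_eval_mono {x y : ℝ} (hx : 0 < x) (hxy : x ≤ y) (j : ℕ) :
    (ascPochhammer ℝ j).eval x ≤ (ascPochhammer ℝ j).eval y := by
  induction j with
  | zero => simp
  | succ j ih =>
    rw [ascPochhammer_succ_eval, ascPochhammer_succ_eval]
    exact mul_le_mul ih (by linarith) (by positivity)
      (ascPochhammer_pos j y (hx.trans_le hxy)).le

/-- Raising c/2 + 1 to c + 1 turns the quotient into the binomial C(c+j, c). -/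
theorem ascPochhammer_div_factorial_le (c j : ℕ) :
    (ascPochhammer ℝ j).eval ((c : ℝ) / 2 + 1) / j.factorial ≤ 2 ^ (c + j) := by
  have hc : (0 : ℝ) ≤ c := c.cast_nonneg
  have h1 := ascPochhammer_eval_mono (x := (c : ℝ) / 2 + 1) (y := c + 1) (by positivity)
    (by linarith) j
  have h2 := ascPochhammer_mul_factorial c j
  have h3 : ((c + j).choose c : ℝ) * (c.factorial * j.factorial) = (c + j).factorial := by
    have := Nat.choose_mul_factorial_mul_factorial (Nat.le_add_right c j)
    rw [Nat.add_sub_cancel_left] at this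
    rw [← this]; push_cast; ring
  have p3 : (c.factorial : ℝ) ≠ 0 := by exact_mod_cast c.factorial_ne_zero
  have h4 : (ascPochhammer ℝ j).eval ((c : ℝ) + 1) = ((c + j).choose c : ℝ) * j.factorial :=
    mul_right_cancel₀ p3 (by rw [h2, ← h3]; ring)
  rw [div_le_iff₀ (by exact_mod_cast j.factorial_pos)]
  refine (h1.trans_eq h4).trans (mul_le_mul_of_nonneg_right ?_ (Nat.cast_nonneg _))
  exact_mod_cast Nat.choose_le_two_pow (c + j) c

theorem exists_norm_legendre_le (c : ℕ) (u : ℂ) : ∃ C B : ℝ, 0 ≤ C ∧ 1 ≤ B ∧ ∀ ℓ : ℕ,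
    ‖(harmonicDim (c + 2) ℓ : ℂ) * Polynomial.aeval (1 - 2 * u) (legendre (c + 2) ℓ)‖ ≤
      C * B ^ ℓ := by
  have hx : (0 : ℝ) ≤ 16 * ‖u‖ := by positivity
  refine ⟨2 ^ (2 * c + 1), 2 * (1 + 16 * ‖u‖), by positivity, by linarith, fun ℓ => ?_⟩
  rw [harmonicDim_mul_aeval_legendre]
  have hterm : ∀ j ∈ Finset.range (ℓ + 1),
      ‖(((ascPochhammer ℝ j).eval ((c : ℝ) / 2 + 1) / j.factorial * zonalCoeff c j ℓ : ℝ) : ℂ) *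
        (-4 * u) ^ j‖ ≤ 2 ^ (2 * c + 1) * 2 ^ ℓ * ((16 * ‖u‖) ^ j * (ℓ.choose j : ℝ)) := by
    intro j hj
    have hj' : j ≤ ℓ := Nat.lt_succ_iff.1 (Finset.mem_range.1 hj)
    have hpos : 0 ≤ (ascPochhammer ℝ j).eval ((c : ℝ) / 2 + 1) / j.factorial :=
      div_nonneg (ascPochhammer_pos j _ (by positivity)).le (Nat.cast_nonneg _)
    have h1 : (zonalCoeff c j ℓ : ℝ) ≤ 2 ^ (ℓ + j + c + 1) := by
      exact_mod_cast zonalCoeff_le c j ℓ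
    have h2 : (1 : ℝ) ≤ ℓ.choose j := by exact_mod_cast Nat.choose_pos hj'
    rw [norm_mul, norm_pow, norm_mul, Complex.norm_real, Real.norm_eq_abs,
      abs_of_nonneg (mul_nonneg hpos (Nat.cast_nonneg _)), norm_neg, Complex.norm_ofNat]
    calc _ ≤ 2 ^ (c + j) * 2 ^ (ℓ + j + c + 1) * (4 * ‖u‖) ^ j := by
          gcongr
          exact ascPochhammer_div_factorial_le c j
      -- The two factors 2^j join 4^j to give 16^j; the 1 is then enlarged to C(ℓ, j) so that the
      -- binomial theorem sums the bounds.
      _ = 2 ^ (2 * c + 1) * 2 ^ ℓ * ((16 * ‖u‖) ^ j * 1) := by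
          rw [show (16 : ℝ) * ‖u‖ = 2 * 2 * (4 * ‖u‖) by ring, mul_pow (2 * 2), mul_pow 2 2]
          ring
      _ ≤ _ := by gcongr
  refine (norm_sum_le_of_le _ hterm).trans (le_of_eq ?_)
  rw [← Finset.mul_sum, mul_pow, add_comm 1 (16 * ‖u‖), add_pow]
  simp only [one_pow, mul_one]
  ring

theorem sphereArea_add_two (c : ℕ) :
    sphereArea (c + 2) = 2 * Real.sqrt Real.pi ^ (c + 2) / Real.Gamma ((c : ℝ) / 2 + 1) := by
  have hG : Real.Gamma (((c + 2 : ℕ) : ℝ) / 2 + 1) =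
      ((c : ℝ) / 2 + 1) * Real.Gamma ((c : ℝ) / 2 + 1) := by
    rw [← Real.Gamma_add_one (by positivity)]
    congr 1
    push_cast
    ring
  rw [sphereArea, MeasureTheory.measureReal_def, MeasureTheory.Measure.toSphere_apply_univ,
    EuclideanSpace.volume_ball, ENNReal.toReal_mul, finrank_euclideanSpace, Fintype.card_fin, hG]
  have hpos : 0 < Real.Gamma ((c : ℝ) / 2 + 1) := Real.Gamma_pos_of_pos (by positivity)
  rw [ENNReal.toReal_mul, ENNReal.toReal_ofReal (by positivity)]
  simp only [ENNReal.ofReal_one, one_pow, ENNReal.toReal_one, ENNReal.toReal_natCast]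
  push_cast
  field_simp

theorem two_pi_pow_div_sphereArea_sq (c : ℕ) :
    (2 * Real.pi) ^ (c + 2) / sphereArea (c + 2) ^ 2 =
      2 ^ c * Real.Gamma ((c : ℝ) / 2 + 1) ^ 2 := by
  have hpos : 0 < Real.Gamma ((c : ℝ) / 2 + 1) := Real.Gamma_pos_of_pos (by positivity)
  have hpi : (Real.sqrt Real.pi ^ (c + 2)) ^ 2 = Real.pi ^ (c + 2) := by
    rw [← pow_mul, mul_comm, pow_mul, Real.sq_sqrt Real.pi_pos.le]
  have hpi0 : 0 < Real.pi := Real.pi_pos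
  rw [sphereArea_add_two, div_pow, mul_pow 2 (Real.sqrt Real.pi ^ (c + 2)), hpi, mul_pow]
  field_simp
  ring

theorem factorial_mul_Gamma_le (c n : ℕ) :
    n.factorial * Real.Gamma ((c : ℝ) / 2 + 1) ≤ Real.Gamma ((c : ℝ) / 2 + 1 + n) := by
  have hpos : 0 < Real.Gamma ((c : ℝ) / 2 + 1) := Real.Gamma_pos_of_pos (by positivity)
  rw [add_comm _ (n : ℝ), Gamma_add_nat _ (by positivity)]
  refine mul_le_mul_of_nonneg_right ?_ hpos.le
  have h := ascPochhammer_eval_mono one_pos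
    (show (1 : ℝ) ≤ (c : ℝ) / 2 + 1 by linarith [show 0 ≤ (c : ℝ) / 2 by positivity]) n
  rwa [ascPochhammer_eval_one] at h

/-- The binomial is at most 2^{2n+c}, which the denominator cancels. Of the decay 1/(n!)² supplied
by the squared Gamma function, one factor 1/n! is kept. -/
theorem exists_abs_phiSqCoeff_le (c : ℕ) :
    ∃ D : ℝ, 0 ≤ D ∧ ∀ ℓ n, |phiSqCoeff c ℓ n| ≤ D / n.factorial := by
  have hpos : 0 < Real.Gamma ((c : ℝ) / 2 + 1) := Real.Gamma_pos_of_pos (by positivity)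
  refine ⟨1 / Real.Gamma ((c : ℝ) / 2 + 1) ^ 2, by positivity, fun ℓ n => ?_⟩
  have hn : (1 : ℝ) ≤ n.factorial := by exact_mod_cast n.factorial_pos
  have hch : ((2 * n + c).choose (n + ℓ + c) : ℝ) ≤ 4 ^ n * 2 ^ c := by
    have := Nat.choose_le_two_pow (2 * n + c) (n + ℓ + c)
    rw [pow_add, pow_mul] at this
    exact_mod_cast this
  have h1 := factorial_mul_Gamma_le c n
  have h2 : n.factorial * Real.Gamma ((c : ℝ) / 2 + 1) ^ 2 ≤
      Real.Gamma ((c : ℝ) / 2 + 1 + n) ^ 2 := by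
    calc _ ≤ (n.factorial * n.factorial : ℝ) * Real.Gamma ((c : ℝ) / 2 + 1) ^ 2 := by
          gcongr
          nlinarith
      _ = (n.factorial * Real.Gamma ((c : ℝ) / 2 + 1)) ^ 2 := by ring
      _ ≤ _ := by gcongr
  have hG : 0 < Real.Gamma ((c : ℝ) / 2 + 1 + n) := Real.Gamma_pos_of_pos (by positivity)
  rw [phiSqCoeff, abs_div, abs_mul, abs_pow, abs_neg, abs_one, one_pow, one_mul,
    Nat.abs_cast, abs_of_pos (show 0 < 4 ^ n * 2 ^ c * Real.Gamma ((c : ℝ) / 2 + 1 + n) ^ 2 by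
      positivity), div_div, div_le_div_iff₀ (by positivity) (by positivity), one_mul]
  calc _ ≤ (4 ^ n * 2 ^ c) * (n.factorial * Real.Gamma ((c : ℝ) / 2 + 1) ^ 2) := by
        rw [mul_comm (n.factorial : ℝ)]
        rw [mul_comm (Real.Gamma ((c : ℝ) / 2 + 1) ^ 2)]
        gcongr
    _ ≤ _ := by gcongr

theorem phiSqCoeff_eq_zero {c ℓ n : ℕ} (h : n < ℓ) : phiSqCoeff c ℓ n = 0 := by
  rw [phiSqCoeff, Nat.choose_eq_zero_of_lt (by omega)]
  simp

/-! ### The double series and the theorem -/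

theorem hasSum_pairing_phi_sq (c ℓ : ℕ) (f : Distr (c + 2))
    (hf : IsCompact (Distribution.dsupport f)) {χ : Test (c + 2)} (hχ : IsCutoff f χ) (κ : ℂ) :
    HasSum (fun n : ℕ => (phiSqCoeff c ℓ n : ℂ) * κ ^ n * evenMoment f χ n)
      (pairing f hf (fun x => phi (c + 2) ℓ (κ ^ (1 / 2 : ℂ) * (‖x‖ : ℂ)) ^ 2)
        (contDiff_phi_sq (c + 2) ℓ κ)) := by
  obtain ⟨D, hD, hcoeff⟩ := exists_abs_phiSqCoeff_le c
  refine hasSum_pairing f hf χ hχ (contDiff_norm_sq ℝ)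
    (fun n => (phiSqCoeff c ℓ n : ℂ) * κ ^ n) (fun M hM => ?_) _ _ (fun x => ?_)
  · refine ((Real.summable_pow_div_factorial (‖κ‖ * M)).mul_left D).of_nonneg_of_le
      (fun n => by positivity) fun n => ?_
    rw [norm_mul, norm_pow, Complex.norm_real, Real.norm_eq_abs]
    calc _ ≤ D / n.factorial * ‖κ‖ ^ n * M ^ n := by
          gcongr
          exact hcoeff ℓ n
      _ = _ := by rw [mul_pow]; ring
  · have hsq : (κ ^ (1 / 2 : ℂ) * (‖x‖ : ℂ)) ^ 2 = κ * ((‖x‖ ^ 2 : ℝ) : ℂ) := by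
      rw [mul_pow, one_div, show ((2 : ℂ)⁻¹) = ((2 : ℕ) : ℂ)⁻¹ by norm_num,
        Complex.cpow_nat_inv_pow κ two_ne_zero, Complex.ofReal_pow]
    refine (hasSum_phi_sq c ℓ hsq).congr_fun fun n => ?_
    rw [mul_pow]
    ring

theorem fourier_eq_tsum_moment_mul_zonal (c : ℕ) (f : Distr (c + 2))
    (hf : IsCompact (Distribution.dsupport f)) (hrad : IsRadial f)
    (κ : ℂ) (hκ : κ ≠ 0) (ξ : E (c + 2)) :
    Summable (fun ℓ : ℕ => ‖moment f hf κ ℓ *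
      zonal (c + 2) ℓ (1 - (‖ξ‖ : ℂ) ^ 2 / (2 * κ))‖) ∧
    fourier f hf ξ = (2 * (Real.pi : ℂ)) ^ (c + 2) *
      ∑' ℓ : ℕ, moment f hf κ ℓ *
        zonal (c + 2) ℓ (1 - (‖ξ‖ : ℂ) ^ 2 / (2 * κ)) := by
  obtain ⟨χ, hχ, hχr⟩ := exists_radial_isCutoff f hf
  obtain ⟨u, hu⟩ : ∃ u : ℂ, u = (‖ξ‖ : ℂ) ^ 2 / (4 * κ) := ⟨_, rfl⟩
  have hz : (1 : ℂ) - (‖ξ‖ : ℂ) ^ 2 / (2 * κ) = 1 - 2 * u := by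
    rw [hu]
    field_simp
    ring
  rw [hz]
  obtain ⟨D, hD, hcoeff⟩ := exists_abs_phiSqCoeff_le c
  obtain ⟨C, M, hC, hM, hmom⟩ := exists_norm_apply_mul_pow_le f χ (contDiff_norm_sq ℝ)
  obtain ⟨C', B, hC', hB, hleg⟩ := exists_norm_legendre_le c u
  obtain ⟨Z, hZ⟩ : ∃ Z : ℕ → ℂ, Z = fun ℓ => (harmonicDim (c + 2) ℓ : ℂ) *
    Polynomial.aeval (1 - 2 * u) (legendre (c + 2) ℓ) := ⟨_, rfl⟩
  obtain ⟨S, hS⟩ : ∃ S : ℕ → ℂ, S = fun ℓ => pairing f hf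
    (fun x => phi (c + 2) ℓ (κ ^ (1 / 2 : ℂ) * (‖x‖ : ℂ)) ^ 2)
      (contDiff_phi_sq (c + 2) ℓ κ) := ⟨_, rfl⟩
  -- Up to |S^{d-1}|^{-2}, summing over n for fixed ℓ gives a term of the zonal series; summing over
  -- ℓ for fixed n gives, up to a constant, a term of the Fourier series.
  let F : ℕ × ℕ → ℂ := fun p =>
    (phiSqCoeff c p.1 p.2 : ℂ) * κ ^ p.2 * evenMoment f χ p.2 * Z p.1
  have hF : Summable fun p => ‖F p‖ := by
    have hbound : Summable fun p : ℕ × ℕ => (1 / 2 : ℝ) ^ p.1 *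
        (D * C * C' * ((‖κ‖ * M * (2 * B)) ^ p.2 / p.2.factorial)) :=
      summable_geometric_two.mul_of_nonneg
        ((Real.summable_pow_div_factorial (‖κ‖ * M * (2 * B))).mul_left (D * C * C'))
        (fun _ => by positivity) (fun _ => by positivity)
    refine hbound.of_nonneg_of_le (fun _ => norm_nonneg _) fun ⟨ℓ, n⟩ => ?_
    rcases lt_or_ge n ℓ with h | h
    · have h0 : F (ℓ, n) = 0 := by simp [F, phiSqCoeff_eq_zero h]
      rw [h0, norm_zero]
      positivity
    -- As ℓ ≤ n, the growth in ℓ can be charged to n, where 1/n! absorbs it, leaving a spare 2^{-ℓ}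
    -- for summation over ℓ.
    · have hBl : B ^ ℓ ≤ (1 / 2) ^ ℓ * (2 * B) ^ n := by
        calc B ^ ℓ = (1 / 2) ^ ℓ * (2 * B) ^ ℓ := by rw [← mul_pow]; ring
          _ ≤ _ := by gcongr; linarith
      have hZl : ‖Z ℓ‖ ≤ C' * B ^ ℓ := by rw [hZ]; exact hleg ℓ
      simp only [F, norm_mul, norm_pow, Complex.norm_real, Real.norm_eq_abs]
      calc _ ≤ D / n.factorial * ‖κ‖ ^ n * (C * M ^ n) * (C' * ((1 / 2) ^ ℓ * (2 * B) ^ n)) := by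
            gcongr
            · exact hcoeff ℓ n
            · exact hmom n
            · exact hZl.trans (by gcongr)
        _ = _ := by rw [mul_pow, mul_pow]; ring
  have hFs : Summable F := hF.of_norm
  have hrow : ∀ ℓ, HasSum (fun n => F (ℓ, n)) (S ℓ * Z ℓ) := fun ℓ => by
    rw [hS]
    exact (hasSum_pairing_phi_sq c ℓ f hf hχ κ).mul_right (Z ℓ)
  have hG : 0 < Real.Gamma ((c : ℝ) / 2 + 1) := Real.Gamma_pos_of_pos (by positivity)
  have hGc : ((Real.Gamma ((c : ℝ) / 2 + 1) : ℝ) : ℂ) ≠ 0 := by exact_mod_cast hG.ne'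
  have hcol : ∀ n, HasSum (fun ℓ => F (ℓ, n)) (1 / (2 ^ c * (Real.Gamma ((c : ℝ) / 2 + 1) : ℂ) ^ 2) *
      ((-1 : ℂ) ^ n * ((‖ξ‖ : ℂ) ^ 2) ^ n / (4 ^ n * n.factorial *
        (((ascPochhammer ℝ n).eval (((c + 2 : ℕ) : ℝ) / 2) : ℝ) : ℂ)) * evenMoment f χ n)) := by
    intro n
    have h0 : ∀ ℓ ∉ Finset.range (n + 1), F (ℓ, n) = 0 := fun ℓ hℓ => by
      simp [F, phiSqCoeff_eq_zero (show n < ℓ by simpa using hℓ)]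
    have h1 : HasSum (fun ℓ => F (ℓ, n)) (∑ ℓ ∈ Finset.range (n + 1), F (ℓ, n)) :=
      hasSum_sum_of_ne_finset_zero h0
    have h2 := sum_choose_mul_legendre c n u
    have hd2 : ((c + 2 : ℕ) : ℝ) / 2 = (c : ℝ) / 2 + 1 := by push_cast; ring
    have hgam : Real.Gamma ((c : ℝ) / 2 + 1 + n) =
        (ascPochhammer ℝ n).eval ((c : ℝ) / 2 + 1) * Real.Gamma ((c : ℝ) / 2 + 1) := by
      rw [add_comm _ (n : ℝ), Gamma_add_nat _ (by positivity)]
    have hA : (((ascPochhammer ℝ n).eval ((c : ℝ) / 2 + 1) : ℝ) : ℂ) ≠ 0 := by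
      exact_mod_cast (ascPochhammer_pos n _ (by positivity)).ne'
    have hfac : (n.factorial : ℂ) ≠ 0 := by exact_mod_cast n.factorial_ne_zero
    have huκ : (4 * u) ^ n * κ ^ n = ((‖ξ‖ : ℂ) ^ 2) ^ n := by
      rw [← mul_pow, hu]
      congr 1
      field_simp
    convert h1 using 1
    have h3 : ∀ ℓ, F (ℓ, n) = ((-1 : ℂ) ^ n * κ ^ n * evenMoment f χ n /
        (4 ^ n * 2 ^ c * ((Real.Gamma ((c : ℝ) / 2 + 1 + n) : ℝ) : ℂ) ^ 2)) *
        ((-1 : ℂ) ^ ℓ * ((2 * n + c).choose (n + ℓ + c) : ℂ) * Z ℓ) := by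
      intro ℓ
      simp only [F, phiSqCoeff]
      push_cast
      rw [pow_add]
      ring
    simp only [h3]
    rw [← Finset.mul_sum, hZ, h2, hd2, hgam, ← huκ]
    push_cast
    generalize (((ascPochhammer ℝ n).eval ((c : ℝ) / 2 + 1) : ℝ) : ℂ) = A at hA ⊢
    generalize ((Real.Gamma ((c : ℝ) / 2 + 1) : ℝ) : ℂ) = G at hGc ⊢
    field_simp
  have hSZ : HasSum (fun ℓ => S ℓ * Z ℓ) (∑' p, F p) := hFs.hasSum.prod_fiberwise hrow
  have hfour := hasSum_fourier (by omega) hf hrad hχ hχr ξ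
  have hswap : HasSum (fun p : ℕ × ℕ => F p.swap) (∑' p, F p) :=
    (Equiv.prodComm ℕ ℕ).hasSum_iff.2 hFs.hasSum
  -- The column sums are a constant multiple of the Fourier series, so the total of F is that
  -- multiple of the transform.
  have hFou := (hswap.prod_fiberwise hcol).unique (hfour.mul_left _)
  have harea : (sphereArea (c + 2) : ℂ) ≠ 0 := by
    rw [sphereArea_add_two]
    have := Real.sqrt_pos.2 Real.pi_pos
    exact_mod_cast (by positivity : 0 < 2 * Real.sqrt Real.pi ^ (c + 2) /
      Real.Gamma ((c : ℝ) / 2 + 1)).ne'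
  have hterm : ∀ ℓ, moment f hf κ ℓ * zonal (c + 2) ℓ (1 - 2 * u) =
      1 / (sphereArea (c + 2) : ℂ) ^ 2 * (S ℓ * Z ℓ) := by
    intro ℓ
    rw [moment, zonal, hS, hZ]
    push_cast
    field_simp
  simp only [hterm]
  refine ⟨?_, ?_⟩
  · simp only [norm_mul]
    refine Summable.mul_left _ ?_
    -- Absolute convergence in ℓ is inherited from the double series, each row sum being bounded by
    -- the sum of norms along its row.
    refine hF.prod.of_nonneg_of_le (fun ℓ => by positivity) fun ℓ => ?_
    rw [← norm_mul, ← (hrow ℓ).tsum_eq]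
    exact norm_tsum_le_tsum_norm (hF.prod_factor ℓ)
  · rw [tsum_mul_left, hSZ.tsum_eq, hFou]
    have h := congrArg (fun r : ℝ => (r : ℂ)) (two_pi_pow_div_sphereArea_sq c)
    push_cast at h
    rw [← mul_assoc, mul_one_div, h, ← mul_assoc,
      mul_one_div_cancel (mul_ne_zero (pow_ne_zero c two_ne_zero) (pow_ne_zero 2 hGc)), one_mul]

end RadialFourier

end
open scoped Distributions in
theorem theorem1 (d : ℕ) (hd : 2 ≤ d)
    (f : 𝓓'((⊤ : TopologicalSpace.Opens (EuclideanSpace ℝ (Fin d))), ℂ))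
    (hf : IsCompact (Distribution.dsupport f)) (hrad : RadialFourier.IsRadial f)
    (κ : ℂ) (hκ : κ ≠ 0) (ξ : EuclideanSpace ℝ (Fin d)) :
    Summable (fun ℓ : ℕ => ‖RadialFourier.moment f hf κ ℓ *
      RadialFourier.zonal d ℓ (1 - (‖ξ‖ : ℂ) ^ 2 / (2 * κ))‖) ∧
    RadialFourier.fourier f hf ξ = (2 * (Real.pi : ℂ)) ^ d *
      ∑' ℓ : ℕ, RadialFourier.moment f hf κ ℓ *
        RadialFourier.zonal d ℓ (1 - (‖ξ‖ : ℂ) ^ 2 / (2 * κ)) := by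
  obtain ⟨c, rfl⟩ := Nat.exists_eq_add_of_le' hd
  exact RadialFourier.fourier_eq_tsum_moment_mul_zonal c f hf hrad κ hκ ξ
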